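/- **Setting.** Two unit-speed agents $A_0,A_1$ start at the origin of the Euclidean plane; a target $I$ lies at an unknown point of the unit circle ("the disk"). A solution consists, for each target $I$, of trajectories $\tau_0^I,\tau_1^I:[0,\infty)\to\mathbb R^2$ that start at the origin, have speed at most $1$, and satisfy the wireless condition: the executions for two targets $I,J$ coincide up to the moment the first of $I,J$ is visited by any agent. Let $T_i(I)$ be the first time at which $A_i$ visits $I$ in the execution for $I$. For $w\in[0,1]$, weighted group search on the disk asks to minimize the search cost $$\sup_{I}\frac{w\,T_0(I)+T_1(I)}{w+1}.$$ Write $c(t)=(\cos t,\sin t)$. For $a,b\ge 0$, $a+b\le 2\pi$, in the $(a,b)$-Detour algorithm the agents move at unit speed as follows. $A_0$ goes straight from the origin to $c(-a)$, then clockwise along the circle to $c(b)$ (an arc of length $2\pi-a-b$), then along the chord to $c(0)$. $A_1$ goes straight from the origin to $c(-a)$, then counter-clockwise along the circle to $c(0)$ (an arc of length $a$), then along the chord to $c(b)$, then clockwise along the circle to $c(0)$. As soon as one agent visits the target it halts there, and the other agent moves straight to the target. For $w\in[0,1]$ consider $$\gamma_1=\alpha+\frac{2\sin\alpha}{w+1},\qquad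 \gamma_2=2\pi-\alpha-\beta+\frac{2\sin\left(\alpha+\frac\beta2+\sin\frac\beta2\right)}{w+1},\qquad \gamma_3=2\sin\frac\beta2+\frac{\alpha+\beta+w(2\pi-\alpha-\beta)}{w+1}.$$ **Statement.** 1. For each $w\in[0,0.2]$ the system $\gamma_1=\gamma_2=\gamma_3$ has exactly one solution $(\alpha_w,\beta_w)$ with $\alpha\ge0$, $\beta>0$, $\alpha+\beta\le2\pi$. There is exactly one $w_0\in[0,0.2]$ with $\alpha_{w_0}=\arccos\left(-\frac{w_0+1}{2}\right)$, and $|w_0-0.0456911|<10^{-7}$. 2. For $w\in[0,1]$ let $(a_w,b_w)=(\alpha_w,\beta_w)$ and $d_w=\alpha_w$ if $w\le w_0$, and $(a_w,b_w)=(\pi,0)$ and $d_w=\arccos\left(-\frac{w+1}{2}\right)$ if $w>w_0$. Then for every $w\in[0,1]$ the $(a_w,b_w)$-Detour algorithm is a solution of weighted group search on the disk in which both agents reach every target in finite time, and its search cost equals $$1+d_w+\frac{2\sin d_w}{w+1}.$$ In particular, the problem admits a solution with search cost at most this value. 3. For $w=1$ this value is $1+\pi$, and it is tight: $1+\pi$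 is the least search cost of any solution of the problem with $w=1$. -/

import Mathlib

open scoped ENNReal

noncomputable section

namespace GroupSearch

/-- The Euclidean plane. -/
abbrev Plane : Type := EuclideanSpace ℝ (Fin 2)

/-- The search domain `disk`: the possible targets are the points at distance exactly `1` from
the origin. -/
def disk : Set Plane := Metric.sphere (0 : Plane) 1

/-- A solution of wireless search with two agents on the domain `D`. Here `τ I i t` is the position
of agent `i` at time `t ≥ 0` in the execution on target `I`. Both agents start at the origin, move
with speed at most `1`, and the executions on two targets `I`, `J` are identical up to the moment
the first of these targets is visited by any agent. -/
structure IsWirelessSearch (D : Set Plane) (τ : D → Fin 2 → ℝ → Plane) : Prop where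
  start : ∀ (I : D) (i : Fin 2), τ I i 0 = 0
  speed : ∀ (I : D) (i : Fin 2), LipschitzOnWith 1 (τ I i) (Set.Ici 0)
  wireless : ∀ (I J : D) (t : ℝ), 0 ≤ t →
    (∀ s, 0 ≤ s → s < t → ∀ j : Fin 2, τ I j s ≠ I) →
    (∀ s, 0 ≤ s → s < t → ∀ j : Fin 2, τ J j s ≠ J) →
    ∀ i : Fin 2, τ I i t = τ J i t

/-- The first time at which agent `i` visits the target `I` in the execution on `I` (`⊤` if it
never does). -/
def termTime {D : Set Plane} (τ : D → Fin 2 → ℝ → Plane) (i : Fin 2) (I : D) : ℝ≥0∞ :=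
  ⨅ (t : ℝ) (_ : 0 ≤ t ∧ τ I i t = I), ENNReal.ofReal t

/-- The search cost, for the cost function `f`:
the supremum over all targets `I` of `f (T₀ I) (T₁ I) / f ‖I‖ ‖I‖`. -/
def searchCost {D : Set Plane} (f : ℝ≥0∞ → ℝ≥0∞ → ℝ≥0∞) (τ : D → Fin 2 → ℝ → Plane) : ℝ≥0∞ :=
  ⨆ I : D, f (termTime τ 0 I) (termTime τ 1 I) / f ‖(I : Plane)‖ₑ ‖(I : Plane)‖ₑ

/-- The cost function `g_w (x, y) = w x + y`. -/
def weightedCost (w : ℝ) (x y : ℝ≥0∞) : ℝ≥0∞ := ENNReal.ofReal w * x + y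

/-- The point `c(t) = (cos t, sin t)`. -/
def circlePt (t : ℝ) : Plane := !₂[Real.cos t, Real.sin t]

/-- Position after time `t ≥ 0` of an agent that moves at unit speed along the segment from `A` to
`B` and stops at `B`. -/
def walk (A B : Plane) (t : ℝ) : Plane := A + (min t (dist A B) / dist A B) • (B - A)

/-- Trajectory of agent `A₀` in the `(a,b)`-Detour Algorithm while no target is found: from the
origin to `c(-a)`, clockwise along the circle to `c(b)` (an arc of length `2π - a - b`), and along
the chord to `c(0)`. -/
def detourPath₀ (a b t : ℝ) : Plane :=
  if t ≤ 1 then walk 0 (circlePt (-a)) t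
  else if t ≤ 1 + (2 * Real.pi - a - b) then circlePt (-a - (t - 1))
  else walk (circlePt b) (circlePt 0) (t - (1 + (2 * Real.pi - a - b)))

/-- Trajectory of agent `A₁` in the `(a,b)`-Detour Algorithm while no target is found: from the
origin to `c(-a)`, counter-clockwise along the circle to `c(0)`, along the chord to `c(b)`, and
clockwise along the circle back to `c(0)`. -/
def detourPath₁ (a b t : ℝ) : Plane :=
  if t ≤ 1 then walk 0 (circlePt (-a)) t
  else if t ≤ 1 + a then circlePt (-a + (t - 1))
  else if t ≤ 1 + a + dist (circlePt 0) (circlePt b) then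
    walk (circlePt 0) (circlePt b) (t - (1 + a))
  else circlePt (b - min (t - (1 + a + dist (circlePt 0) (circlePt b))) b)

/-- The first time at which one of two agents that follow the trajectories `p` visits `I`. -/
def findTime (p : Fin 2 → ℝ → Plane) (I : Plane) : ℝ :=
  sInf {t : ℝ | 0 ≤ t ∧ ∃ i, p i t = I}

open Classical in
/-- The execution on target `I` in which the agents follow the trajectories `p` until one of them
visits `I`; from that moment on each agent moves straight to `I` at unit speed and stays there
(in particular the finder halts). -/
def respond (p : Fin 2 → ℝ → Plane) (I : Plane) (i : Fin 2) (t : ℝ) : Plane :=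
  if ∃ s, 0 ≤ s ∧ s ≤ t ∧ ∃ j, p j s = I then
    walk (p i (findTime p I)) I (t - findTime p I)
  else p i t

/-- The `(a,b)`-Detour Algorithm on the disk. -/
def detour (a b : ℝ) (I : disk) (i : Fin 2) (t : ℝ) : Plane :=
  respond ![detourPath₀ a b, detourPath₁ a b] I i t

def γ₁ (w α : ℝ) : ℝ := α + 2 * Real.sin α / (w + 1)

def γ₂ (w α β : ℝ) : ℝ :=
  2 * Real.pi - α - β + 2 * Real.sin (α + β / 2 + Real.sin (β / 2)) / (w + 1)

def γ₃ (w α β : ℝ) : ℝ :=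
  2 * Real.sin (β / 2) + (α + β + w * (-α - β + 2 * Real.pi)) / (w + 1)

/-- `(α, β)` solves the system `γ₁ = γ₂ = γ₃` and is an admissible pair of parameters of a Detour
Algorithm with a nontrivial detour. (Without the condition `0 < β` the pair `(π, 0)` solves the
system for every `w`.) -/
structure IsDetourSolution (w α β : ℝ) : Prop where
  nonneg : 0 ≤ α
  pos : 0 < β
  le : α + β ≤ 2 * Real.pi
  eq₁₂ : γ₁ w α = γ₂ w α β
  eq₂₃ : γ₂ w α β = γ₃ w α β

end GroupSearch

end

namespace GroupSearch

/-! The cost of a Detour algorithm is controlled target by target. While both agents sweep the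
circle away from `c(-a)`, a target found after arc length `s` by `A₀` costs `1 + s + 2 sin s /
(w+1)`; since `w ≤ 1`, one found by `A₁` costs no more. This expression increases up to `s =
arccos(-(w+1)/2)` and then decreases. For `w > w₀` the detour is empty and the interior maximum is
the cost. For `w ≤ w₀` the first sweep stops at `α`, before the maximum; the other worst cases are
the end of the arc of `A₀` (`γ₂`) and the end of the return of `A₁` (`γ₃`), and the system balances
these with `γ₁`. It remains to see that targets found while `A₁` is on the chord are no worse.
`searchCost_detour_le` and `le_searchCost_detour` make this precise; `dist_walk_chord_le` is the
chord estimate.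

For the system put `k = 1/(w+1)`, `x = π - α`, `y = β/2`, and let `E₁`, `E₂` be `detourEq₁`,
`detourEq₂`. For given `x`, `E₁ = 0` has one relevant root `y`. Along this curve `y/x` decreases
(`ratio_lt_of_detourEq₁`), and a scaling argument then shows that `E₂`, once nonpositive, is
negative from there on (`detourEq₂_neg_of_lt`). This gives uniqueness; the intermediate value
theorem along the curve (`exists_detourEq_eq_zero`) gives existence.

At the threshold `2 cos x = w + 1`. After elimination of `w`, the two remaining equations are
monotone in suitable combinations (`threshold_transversal`), so there is only one threshold, an
approximate root locates it, and for `w ≤ w₀` the root `x` lies on the required side of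
`arccos((w+1)/2)`.

For `w = 1` the lower bound tests `n` equidistant targets: in the execution for the one found last,
the two agents together visit all of them, and each agent pays at least one chord between two visits
(`exists_late_target`). Let `n → ∞`. -/

/-! ### Chords of the unit circle. -/

theorem dist_circlePt (s t : ℝ) :
    dist (circlePt s) (circlePt t) = 2 * |Real.sin ((s - t) / 2)| := by
  rw [EuclideanSpace.dist_eq, ← Real.sqrt_sq (by positivity : 0 ≤ 2 * |Real.sin ((s - t) / 2)|)]
  congr 1
  have hs : s = (s + t) / 2 + (s - t) / 2 := by ring
  have ht : t = (s + t) / 2 - (s - t) / 2 := by ring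
  have h1 := Real.sin_sq_add_cos_sq ((s + t) / 2)
  simp only [circlePt, Fin.sum_univ_two, Real.dist_eq, sq_abs, mul_pow]
  simp only [Matrix.cons_val_zero, Matrix.cons_val_one]
  have e1 : Real.cos s - Real.cos t = -2 * Real.sin ((s + t) / 2) * Real.sin ((s - t) / 2) := by
    rw [Real.cos_sub_cos]
  have e2 : Real.sin s - Real.sin t = 2 * Real.sin ((s - t) / 2) * Real.cos ((s + t) / 2) := by
    rw [Real.sin_sub_sin]
  rw [e1, e2]
  linear_combination 4 * Real.sin ((s - t) / 2) ^ 2 * h1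

theorem dist_circlePt_le (s t : ℝ) : dist (circlePt s) (circlePt t) ≤ |s - t| := by
  rw [dist_circlePt]
  have := Real.abs_sin_le_abs (x := (s - t) / 2)
  rw [abs_div, abs_two] at this
  linarith

theorem norm_circlePt (t : ℝ) : ‖circlePt t‖ = 1 := by
  rw [EuclideanSpace.norm_eq]
  simp [circlePt, Fin.sum_univ_two]

theorem circlePt_mem_disk (t : ℝ) : circlePt t ∈ disk := by
  simp [disk, norm_circlePt]

/-- The target `c(t)`. -/
noncomputable def circleTarget (t : ℝ) : disk := ⟨circlePt t, circlePt_mem_disk t⟩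

/-! ### The lower bound for equal weights. -/

/-- Points of an interval of length `y` that are pairwise `δ` apart. -/
theorem card_mul_le_of_separated {ι : Type*} (S : Finset ι) (t : ι → ℝ) {a y δ : ℝ} (hδ : 0 < δ)
    (hy : 0 ≤ y) (ht : ∀ i ∈ S, a ≤ t i ∧ t i ≤ a + y)
    (hsep : ∀ i ∈ S, ∀ j ∈ S, i ≠ j → δ ≤ |t i - t j|) : ((S.card : ℝ) - 1) * δ ≤ y := by
  have hcard : S.card ≤ (Finset.range (⌊y / δ⌋₊ + 1)).card := by
    apply Finset.card_le_card_of_injOn (fun i => ⌊(t i - a) / δ⌋₊)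
    · intro i hi
      have h := ht i hi
      simp only [Finset.coe_range, Set.mem_Iio]
      apply Nat.lt_succ_of_le
      apply Nat.floor_le_floor
      gcongr
      linarith
    · intro i hi j hj hij
      by_contra hne
      have h := hsep i hi j hj hne
      have hi0 : 0 ≤ (t i - a) / δ := div_nonneg (by linarith [ht i hi]) hδ.le
      have hj0 : 0 ≤ (t j - a) / δ := div_nonneg (by linarith [ht j hj]) hδ.le
      have h1 := Nat.floor_le hi0
      have h2 := Nat.lt_floor_add_one ((t i - a) / δ)
      have h3 := Nat.floor_le hj0
      have h4 := Nat.lt_floor_add_one ((t j - a) / δ)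
      simp only at hij
      rw [hij] at h1 h2
      rw [div_lt_iff₀ hδ] at h2 h4
      rw [le_div_iff₀ hδ] at h1 h3
      rcases abs_cases (t i - t j) with ⟨e, _⟩ | ⟨e, _⟩ <;> rw [e] at h <;> nlinarith
  rw [Finset.card_range] at hcard
  have h5 : (S.card : ℝ) ≤ (⌊y / δ⌋₊ : ℝ) + 1 := by exact_mod_cast hcard
  have h6 := Nat.floor_le (div_nonneg hy hδ.le)
  rw [le_div_iff₀ hδ] at h6
  nlinarith

theorem two_mul_sin_le_dist_circlePt {n : ℕ} {i j : Fin n} (hij : i ≠ j) :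
    2 * Real.sin (Real.pi / n) ≤
      dist (circlePt (2 * Real.pi * i / n)) (circlePt (2 * Real.pi * j / n)) := by
  wlog h : j < i generalizing i j
  · rw [dist_comm]
    exact this hij.symm (lt_of_le_of_ne (not_lt.mp h) hij)
  have hn : (0 : ℝ) < n := by
    have := i.pos
    exact_mod_cast this
  have hji : ((j : ℕ) : ℝ) + 1 ≤ (i : ℕ) := by exact_mod_cast h
  have hin : ((i : ℕ) : ℝ) + 1 ≤ n := by exact_mod_cast i.2
  have hj0 : (0 : ℝ) ≤ (j : ℕ) := Nat.cast_nonneg _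
  rw [dist_circlePt]
  have e : (2 * Real.pi * i / n - 2 * Real.pi * j / n) / 2 = Real.pi / n * ((i : ℕ) - (j : ℕ)) := by
    field_simp
  rw [e]
  set z := Real.pi / n with hz
  have hz0 : 0 < z := by positivity
  have hzn : z * n = Real.pi := by rw [hz]; field_simp
  refine mul_le_mul_of_nonneg_left (le_trans ?_ (le_abs_self _)) (by norm_num)
  rcases le_total (z * ((i : ℕ) - (j : ℕ))) (Real.pi / 2) with h1 | h1
  · apply Real.sin_le_sin_of_le_of_le_pi_div_two <;> nlinarith [Real.pi_pos]
  · rw [← Real.sin_pi_sub (z * ((i : ℕ) - (j : ℕ)))]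
    apply Real.sin_le_sin_of_le_of_le_pi_div_two <;> nlinarith [Real.pi_pos]

/-- In every solution there is a target that no agent visits before the agents could have jointly
visited `n` equidistant points of the circle. -/
theorem exists_late_target {τ : disk → Fin 2 → ℝ → Plane} (hτ : IsWirelessSearch disk τ)
    {n : ℕ} (hn : 2 ≤ n) :
    ∃ J : disk, ∀ i t, 0 ≤ t → τ J i t = J → 1 + (n - 2) * Real.sin (Real.pi / n) ≤ t := by
  have hn2 : (2 : ℝ) ≤ n := by exact_mod_cast hn
  have hn0 : (0 : ℝ) < n := by linarith
  let I : Fin n → disk := fun j => circleTarget (2 * Real.pi * j / n)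
  let V : Fin n → Set ℝ := fun j => {t | 0 ≤ t ∧ ∃ i, τ (I j) i t = I j}
  by_cases hne : ∀ j, (V j).Nonempty
  swap
  · push Not at hne
    obtain ⟨j, hj⟩ := hne
    refine ⟨I j, fun i t ht h => ?_⟩
    have : t ∈ V j := ⟨ht, i, h⟩
    rw [hj] at this
    exact this.elim
  have hclosed : ∀ j, IsClosed (V j) := by
    intro j
    have : V j = ⋃ i : Fin 2, (Set.Ici 0 ∩ τ (I j) i ⁻¹' {(I j : Plane)}) := by
      ext t
      simp [V]
    rw [this]
    exact isClosed_iUnion_of_finite fun i =>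
      (hτ.speed (I j) i).continuousOn.preimage_isClosed_of_isClosed isClosed_Ici isClosed_singleton
  have hbdd : ∀ j, BddBelow (V j) := fun j => ⟨0, fun t ht => ht.1⟩
  let T : Fin n → ℝ := fun j => sInf (V j)
  have hT : ∀ j, T j ∈ V j := fun j => (hclosed j).csInf_mem (hne j) (hbdd j)
  have hTle : ∀ j t, t ∈ V j → T j ≤ t := fun j t ht => csInf_le (hbdd j) ht
  have : Nonempty (Fin n) := ⟨⟨0, by omega⟩⟩
  obtain ⟨m, hm⟩ := Finite.exists_max T
  have hvis : ∀ j, ∃ i, τ (I m) i (T j) = I j := by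
    intro j
    obtain ⟨h0, i, hi⟩ := hT j
    refine ⟨i, ?_⟩
    rw [← hi]
    -- Before `T j ≤ T m` neither target has been visited, so the execution on `I m` still agrees
    -- with the one on `I j`.
    apply hτ.wireless (I m) (I j) (T j) h0
    · intro s hs hlt i' he
      exact absurd (hTle m s ⟨hs, i', he⟩) (by linarith [hm j])
    · intro s hs hlt i' he
      exact absurd (hTle j s ⟨hs, i', he⟩) (by linarith)
  have hlip : ∀ i s t, 0 ≤ s → 0 ≤ t → dist (τ (I m) i s) (τ (I m) i t) ≤ |s - t| := by
    intro i s t hs ht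
    have := (hτ.speed (I m) i).dist_le_mul s hs t ht
    simpa [Real.dist_eq] using this
  have hT1 : ∀ j, 1 ≤ T j := by
    intro j
    obtain ⟨i, hi⟩ := hvis j
    have := hlip i (T j) 0 (hT j).1 le_rfl
    rw [hi, hτ.start, sub_zero, abs_of_nonneg (hT j).1] at this
    simpa [I, circleTarget, norm_circlePt] using this
  have hδ : 0 < 2 * Real.sin (Real.pi / n) := by
    have : 0 < Real.sin (Real.pi / n) := by
      apply Real.sin_pos_of_pos_of_lt_pi (by positivity)
      exact div_lt_self Real.pi_pos (by linarith)
    linarith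
  classical
  -- The points are split by visiting agent. With `|S i|` points an agent needs time `|S i| - 1`
  -- chords after time `1`; adding the two bounds produces the factor `n - 2`.
  let S : Fin 2 → Finset (Fin n) := fun i => Finset.univ.filter fun j => τ (I m) i (T j) = I j
  have hS : ∀ i, (((S i).card : ℝ) - 1) * (2 * Real.sin (Real.pi / n)) ≤ T m - 1 := by
    intro i
    apply card_mul_le_of_separated (S i) T (a := 1) hδ (by linarith [hT1 m])
    · intro j _
      exact ⟨hT1 j, by linarith [hm j]⟩
    · intro j hj j' hj' hne'
      have h1 := (Finset.mem_filter.mp hj).2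
      have h2 := (Finset.mem_filter.mp hj').2
      refine le_trans ?_ (hlip i (T j) (T j') (hT j).1 (hT j').1)
      rw [h1, h2]
      exact two_mul_sin_le_dist_circlePt hne'
  have hcard : n ≤ (S 0).card + (S 1).card := by
    have hU : (Finset.univ : Finset (Fin n)) ⊆ S 0 ∪ S 1 := by
      intro j _
      obtain ⟨i, hi⟩ := hvis j
      fin_cases i
      · exact Finset.mem_union_left _ (Finset.mem_filter.mpr ⟨Finset.mem_univ _, hi⟩)
      · exact Finset.mem_union_right _ (Finset.mem_filter.mpr ⟨Finset.mem_univ _, hi⟩)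
    have := (Finset.card_le_card hU).trans (Finset.card_union_le _ _)
    simpa using this
  have hcard' : (n : ℝ) ≤ (S 0).card + (S 1).card := by exact_mod_cast hcard
  refine ⟨I m, fun i t ht h => ?_⟩
  have h0 := hS 0
  have h1 := hS 1
  have h2 := hTle m t ⟨ht, i, h⟩
  nlinarith

theorem tendsto_late_time :
    Filter.Tendsto (fun n : ℕ => 1 + ((n : ℝ) - 2) * Real.sin (Real.pi / n)) Filter.atTop
      (nhds (1 + Real.pi)) := by
  have h0 : Filter.Tendsto (fun n : ℕ => Real.pi / (n : ℝ)) Filter.atTop (nhds 0) :=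
    tendsto_const_div_atTop_nhds_zero_nat _
  -- With `z = π / n` one has `n sin z = π sinc z`, which is continuous at `0`.
  have hc : Filter.Tendsto (fun z : ℝ => 1 + (Real.pi * Real.sinc z - 2 * Real.sin z)) (nhds 0)
      (nhds (1 + Real.pi)) := by
    have : Continuous fun z : ℝ => 1 + (Real.pi * Real.sinc z - 2 * Real.sin z) := by fun_prop
    simpa using this.tendsto 0
  refine (hc.comp h0).congr' ?_
  filter_upwards [Filter.eventually_gt_atTop 0] with n hn
  have hn' : (n : ℝ) ≠ 0 := by positivity
  have hz : Real.pi / (n : ℝ) ≠ 0 := div_ne_zero Real.pi_ne_zero hn'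
  simp only [Function.comp]
  rw [Real.sinc_of_ne_zero hz]
  have := Real.pi_ne_zero
  field_simp

theorem le_termTime {D : Set Plane} {τ : D → Fin 2 → ℝ → Plane} {i : Fin 2} {I : D} {c : ℝ}
    (h : ∀ t, 0 ≤ t → τ I i t = I → c ≤ t) : ENNReal.ofReal c ≤ termTime τ i I :=
  le_iInf₂ fun t ht => ENNReal.ofReal_le_ofReal (h t ht.1 ht.2)

theorem termTime_le {D : Set Plane} {τ : D → Fin 2 → ℝ → Plane} {i : Fin 2} {I : D} {t : ℝ}
    (ht : 0 ≤ t) (h : τ I i t = I) : termTime τ i I ≤ ENNReal.ofReal t :=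
  iInf₂_le t ⟨ht, h⟩

theorem enorm_disk (I : disk) : ‖(I : Plane)‖ₑ = 1 := by
  have h : (I : Plane) ∈ Metric.sphere 0 1 := I.2
  rw [mem_sphere_zero_iff_norm] at h
  rw [← ofReal_norm, h, ENNReal.ofReal_one]

theorem weightedCost_one {w : ℝ} (hw : 0 ≤ w) (I : disk) :
    weightedCost w ‖(I : Plane)‖ₑ ‖(I : Plane)‖ₑ = ENNReal.ofReal (w + 1) := by
  rw [enorm_disk, weightedCost, mul_one, ENNReal.ofReal_add hw zero_le_one, ENNReal.ofReal_one]

theorem weightedCost_mono {w : ℝ} {x y x' y' : ℝ≥0∞} (hx : x ≤ x') (hy : y ≤ y') :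
    weightedCost w x y ≤ weightedCost w x' y' := by
  unfold weightedCost
  gcongr

theorem weightedCost_ofReal {w x y : ℝ} (hw : 0 ≤ w) (hx : 0 ≤ x) (hy : 0 ≤ y) :
    weightedCost w (ENNReal.ofReal x) (ENNReal.ofReal y) = ENNReal.ofReal (w * x + y) := by
  rw [weightedCost, ← ENNReal.ofReal_mul hw, ENNReal.ofReal_add (by positivity) hy]

theorem le_searchCost_one {τ : disk → Fin 2 → ℝ → Plane} (hτ : IsWirelessSearch disk τ) :
    ENNReal.ofReal (1 + Real.pi) ≤ searchCost (weightedCost 1) τ := by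
  refine le_of_tendsto (ENNReal.tendsto_ofReal tendsto_late_time) ?_
  filter_upwards [Filter.eventually_ge_atTop 2] with n hn
  obtain ⟨J, hJ⟩ := exists_late_target hτ hn
  refine le_trans ?_ (le_iSup _ J)
  have hn2 : (2 : ℝ) ≤ n := by exact_mod_cast hn
  have hs : 0 ≤ Real.sin (Real.pi / n) :=
    Real.sin_nonneg_of_nonneg_of_le_pi (by positivity) (div_le_self Real.pi_pos.le (by linarith))
  set c := 1 + ((n : ℝ) - 2) * Real.sin (Real.pi / n) with hc
  have hc0 : 0 ≤ c := by
    have : 0 ≤ (n : ℝ) - 2 := by linarith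
    positivity
  rw [weightedCost_one zero_le_one, ENNReal.le_div_iff_mul_le (by simp) (by simp),
    ← ENNReal.ofReal_mul hc0, show c * (1 + 1) = 1 * c + c by ring,
    ← weightedCost_ofReal zero_le_one hc0 hc0]
  exact weightedCost_mono (le_termTime (hJ 0)) (le_termTime (hJ 1))

/-! ### Trajectories, and responding to a found target. -/

theorem dist_le_abs_of_glue (f g : ℝ → Plane) {S : Set ℝ} {c : ℝ} (hcS : c ∈ S)
    (hf : ∀ s ∈ S, ∀ t ∈ S, dist (f s) (f t) ≤ |s - t|) (hg : ∀ s t, dist (g s) (g t) ≤ |s - t|)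
    (hfg : f c = g c) :
    ∀ s ∈ S, ∀ t ∈ S, dist (if s ≤ c then f s else g s) (if t ≤ c then f t else g t) ≤ |s - t| := by
  have key : ∀ s ∈ S, ∀ t, s ≤ c → c < t → dist (f s) (g t) ≤ |s - t| := by
    intro s hs t hsc hct
    calc dist (f s) (g t) ≤ dist (f s) (f c) + dist (g c) (g t) := by
          rw [hfg]; exact dist_triangle _ _ _
      _ ≤ |s - c| + |c - t| := add_le_add (hf s hs c hcS) (hg c t)
      _ = |s - t| := by
          rw [abs_of_nonpos (by linarith), abs_of_nonpos (by linarith),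
            abs_of_nonpos (by linarith)]
          ring
  intro s hs t ht
  split_ifs with h1 h2 h2
  · exact hf s hs t ht
  · exact key s hs t h1 (not_le.mp h2)
  · rw [dist_comm, abs_sub_comm]
    exact key t ht s h2 (not_le.mp h1)
  · exact hg s t

theorem dist_walk_le (A B : Plane) (s t : ℝ) : dist (walk A B s) (walk A B t) ≤ |s - t| := by
  unfold walk
  rw [dist_add_left, dist_eq_norm, ← sub_smul, norm_smul, ← dist_eq_norm B A, dist_comm B A,
    ← sub_div, Real.norm_eq_abs, abs_div, abs_of_nonneg (dist_nonneg (x := A) (y := B))]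
  rcases eq_or_ne (dist A B) 0 with h | h
  · rw [h]; simp
  · rw [div_mul_cancel₀ _ h]
    exact (abs_min_sub_min_le_max _ _ _ _).trans (by simp)

theorem walk_zero (A B : Plane) : walk A B 0 = A := by
  simp [walk]

theorem walk_of_dist_le {A B : Plane} {t : ℝ} (h : dist A B ≤ t) : walk A B t = B := by
  unfold walk
  rcases eq_or_ne A B with rfl | hne
  · simp
  · rw [min_eq_right h, div_self (dist_ne_zero.mpr hne)]
    simp

theorem walk_of_le {A B : Plane} {t : ℝ} (h : t ≤ dist A B) :
    walk A B t = A + (t / dist A B) • (B - A) := by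
  rw [walk, min_eq_left h]

/-- Two unit speed trajectories that start at the origin. -/
structure IsTrajectoryPair (p : Fin 2 → ℝ → Plane) : Prop where
  start : ∀ i, p i 0 = 0
  speed : ∀ i, ∀ s ∈ Set.Ici (0 : ℝ), ∀ t ∈ Set.Ici (0 : ℝ), dist (p i s) (p i t) ≤ |s - t|

section Respond

variable {p : Fin 2 → ℝ → Plane}

theorem findTime_le {I : Plane} {t : ℝ} (ht : 0 ≤ t) {j : Fin 2} (h : p j t = I) :
    findTime p I ≤ t :=
  csInf_le ⟨0, fun _ hs => hs.1⟩ ⟨ht, j, h⟩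

theorem findTime_mem (hp : IsTrajectoryPair p) {I : Plane} (h : ∃ t, 0 ≤ t ∧ ∃ j, p j t = I) :
    0 ≤ findTime p I ∧ ∃ j, p j (findTime p I) = I := by
  have hc : IsClosed {t : ℝ | 0 ≤ t ∧ ∃ i, p i t = I} := by
    have : {t : ℝ | 0 ≤ t ∧ ∃ i, p i t = I} = ⋃ i : Fin 2, (Set.Ici 0 ∩ p i ⁻¹' {I}) := by
      ext t
      simp
    rw [this]
    refine isClosed_iUnion_of_finite fun i => ?_
    have hl : LipschitzOnWith 1 (p i) (Set.Ici 0) := LipschitzOnWith.of_dist_le_mul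
      fun s hs t ht => by simpa [Real.dist_eq] using hp.speed i s hs t ht
    exact hl.continuousOn.preimage_isClosed_of_isClosed isClosed_Ici isClosed_singleton
  exact hc.csInf_mem h ⟨0, fun _ hs => hs.1⟩

theorem respond_of_not_exists {I : Plane} (h : ¬∃ t, 0 ≤ t ∧ ∃ j, p j t = I) (i : Fin 2) (t : ℝ) :
    respond p I i t = p i t := by
  rw [respond, if_neg]
  rintro ⟨s, h0, -, h1⟩
  exact h ⟨s, h0, h1⟩

theorem respond_eq (hp : IsTrajectoryPair p) {I : Plane} (h : ∃ t, 0 ≤ t ∧ ∃ j, p j t = I)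
    (i : Fin 2) (t : ℝ) :
    respond p I i t = if t ≤ findTime p I then p i t
      else walk (p i (findTime p I)) I (t - findTime p I) := by
  obtain ⟨h0, j, hj⟩ := findTime_mem hp h
  by_cases hs : ∃ s, 0 ≤ s ∧ s ≤ t ∧ ∃ j, p j s = I
  · rw [respond, if_pos hs]
    split_ifs with hle
    · obtain ⟨s, hs0, hst, j', hj'⟩ := hs
      have := findTime_le hs0 hj'
      rw [show t = findTime p I by linarith, sub_self, walk_zero]
    · rfl
  · rw [respond, if_neg hs, if_pos]
    by_contra hlt
    exact hs ⟨_, h0, (not_le.mp hlt).le, j, hj⟩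

/-- The right-hand side does not depend on `I`; the wireless condition follows at once. -/
theorem respond_of_unvisited (hp : IsTrajectoryPair p) {I : Plane} {t : ℝ}
    (h : ∀ s, 0 ≤ s → s < t → ∀ j, respond p I j s ≠ I) (i : Fin 2) :
    respond p I i t = p i t := by
  by_cases hI : ∃ t, 0 ≤ t ∧ ∃ j, p j t = I
  · rw [respond_eq hp hI, if_pos]
    by_contra hlt
    obtain ⟨h0, j, hj⟩ := findTime_mem hp hI
    refine h _ h0 (not_le.mp hlt) j ?_
    rw [respond_eq hp hI, if_pos le_rfl, hj]
  · exact respond_of_not_exists hI i t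

theorem isWirelessSearch_respond (hp : IsTrajectoryPair p) (D : Set Plane) :
    IsWirelessSearch D fun I => respond p I where
  start I i := by
    rw [← hp.start i]
    exact respond_of_unvisited hp (fun s h0 h1 => absurd h0 (not_le.mpr h1)) i
  speed I i := by
    refine LipschitzOnWith.of_dist_le_mul fun s hs t ht => ?_
    rw [NNReal.coe_one, one_mul, Real.dist_eq]
    by_cases hI : ∃ t, 0 ≤ t ∧ ∃ j, p j t = (I : Plane)
    · simp only [respond_eq hp hI]
      have h0 := (findTime_mem hp hI).1
      refine dist_le_abs_of_glue (p i) (fun t => walk (p i (findTime p I)) I (t - findTime p I))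
        (S := Set.Ici 0) h0 (hp.speed i) (fun s t => ?_) ?_ s hs t ht
      · refine (dist_walk_le _ _ _ _).trans_eq ?_
        congr 1
        ring
      · rw [sub_self, walk_zero]
    · simp only [respond_of_not_exists hI]
      exact hp.speed i s hs t ht
  wireless I J t _ hI hJ i := by
    rw [respond_of_unvisited hp hI, respond_of_unvisited hp hJ]

/-- Any visiting time `t` serves, not only the first one `F`: by the speed limit, `F + dist (p i F)
I ≤ t + dist (p i t) I`. Upper bounds therefore never have to identify the first finder. -/
theorem termTime_respond_le (hp : IsTrajectoryPair p) {D : Set Plane} (I : D) {t : ℝ} (ht : 0 ≤ t)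
    {j : Fin 2} (h : p j t = I) (i : Fin 2) :
    termTime (fun I : D => respond p I) i I ≤ ENNReal.ofReal (t + dist (p i t) I) := by
  have hI : ∃ t, 0 ≤ t ∧ ∃ j, p j t = (I : Plane) := ⟨t, ht, j, h⟩
  obtain ⟨h0, -⟩ := findTime_mem hp hI
  have hle := findTime_le ht h
  set F := findTime p I with hF
  have h1 : termTime (fun I : D => respond p I) i I ≤ ENNReal.ofReal (F + dist (p i F) I) := by
    refine termTime_le (by positivity) ?_
    rw [respond_eq hp hI, ← hF]
    split_ifs with hc
    · have hd : dist (p i F) (I : Plane) = 0 := le_antisymm (by linarith) dist_nonneg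
      rw [hd, add_zero]
      exact dist_eq_zero.mp hd
    · rw [add_sub_cancel_left]
      exact walk_of_dist_le le_rfl
  refine h1.trans (ENNReal.ofReal_le_ofReal ?_)
  have h2 := hp.speed i F h0 t ht
  rw [abs_of_nonpos (by linarith)] at h2
  linarith [dist_triangle (p i F) (p i t) I]

/-- Here `F` must be the first visit; after `F` the speed limit leaves the agent no faster way to
`I` than the straight one. -/
theorem le_termTime_respond (hp : IsTrajectoryPair p) {D : Set Plane} (I : D) {F : ℝ} (hF : 0 ≤ F)
    {j : Fin 2} (h : p j F = I) (hfirst : ∀ t, 0 ≤ t → ∀ i, p i t = I → F ≤ t) (i : Fin 2) :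
    ENNReal.ofReal (F + dist (p i F) I) ≤ termTime (fun I : D => respond p I) i I := by
  have hI : ∃ t, 0 ≤ t ∧ ∃ j, p j t = (I : Plane) := ⟨F, hF, j, h⟩
  obtain ⟨h0, j', hj'⟩ := findTime_mem hp hI
  have hFF : findTime p I = F := le_antisymm (findTime_le hF h) (hfirst _ h0 _ hj')
  refine le_termTime fun t ht hvis => ?_
  have hs := ((isWirelessSearch_respond hp D).speed I i).dist_le_mul F hF t ht
  rw [NNReal.coe_one, one_mul, Real.dist_eq] at hs
  have hpF : respond p I i F = p i F := by
    rw [respond_eq hp hI, hFF, if_pos le_rfl]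
  rw [hpF, hvis] at hs
  have hFt : F ≤ t := by
    by_contra hlt
    push Not at hlt
    rw [respond_eq hp hI, hFF, if_pos hlt.le] at hvis
    exact absurd (hfirst t ht i hvis) (not_le.mpr hlt)
  rw [abs_of_nonpos (by linarith)] at hs
  linarith

end Respond

/-! ### The detour trajectories and the positions along them. -/

section Detour

variable {a b : ℝ}

theorem circlePt_sub_two_pi (t : ℝ) : circlePt (t - 2 * Real.pi) = circlePt t := by
  simp [circlePt]

theorem dist_zero_circlePt (t : ℝ) : dist 0 (circlePt t) = 1 := by
  rw [dist_zero_left, norm_circlePt]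

theorem isTrajectoryPair_detour (ha : 0 ≤ a) (hb : 0 ≤ b) (hab : a + b ≤ 2 * Real.pi) :
    IsTrajectoryPair ![detourPath₀ a b, detourPath₁ a b] := by
  have hsub : ∀ s t c : ℝ, |s - c - (t - c)| = |s - t| := fun s t c => by
    congr 1; ring
  constructor
  · intro i
    fin_cases i <;> simp [detourPath₀, detourPath₁, walk_zero]
  · intro i
    fin_cases i
    · simp only [Fin.zero_eta, Matrix.cons_val_zero, detourPath₀]
      refine dist_le_abs_of_glue (fun t => walk 0 (circlePt (-a)) t)
        (fun t => if t ≤ 1 + (2 * Real.pi - a - b) then circlePt (-a - (t - 1)) else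
          walk (circlePt b) (circlePt 0) (t - (1 + (2 * Real.pi - a - b))))
        (S := Set.Ici 0) (Set.mem_Ici.mpr zero_le_one)
        (fun s _ t _ => dist_walk_le _ _ s t) (fun s t => ?_) ?_
      · refine dist_le_abs_of_glue (fun t => circlePt (-a - (t - 1)))
          (fun t => walk (circlePt b) (circlePt 0) (t - (1 + (2 * Real.pi - a - b))))
          (S := Set.univ) (Set.mem_univ _) (fun s _ t _ => ?_)
          (fun s t => ?_) ?_ s (Set.mem_univ _) t (Set.mem_univ _)
        · refine (dist_circlePt_le _ _).trans_eq ?_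
          rw [abs_sub_comm]
          congr 1
          ring
        · exact (dist_walk_le _ _ _ _).trans_eq (hsub _ _ _)
        · rw [sub_self, walk_zero, ← circlePt_sub_two_pi b]
          congr 1
          ring
      · rw [if_pos (by linarith), walk_of_dist_le (dist_zero_circlePt _).le]
        simp
    · simp only [Fin.mk_one, Matrix.cons_val_one]
      refine dist_le_abs_of_glue (fun t => walk 0 (circlePt (-a)) t)
        (fun t => if t ≤ 1 + a then circlePt (-a + (t - 1)) else
          if t ≤ 1 + a + dist (circlePt 0) (circlePt b) then
            walk (circlePt 0) (circlePt b) (t - (1 + a))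
          else circlePt (b - min (t - (1 + a + dist (circlePt 0) (circlePt b))) b))
        (S := Set.Ici 0) (Set.mem_Ici.mpr zero_le_one)
        (fun s _ t _ => dist_walk_le _ _ s t) (fun s t => ?_) ?_
      · refine dist_le_abs_of_glue (fun t => circlePt (-a + (t - 1)))
          (fun t => if t ≤ 1 + a + dist (circlePt 0) (circlePt b) then
            walk (circlePt 0) (circlePt b) (t - (1 + a))
          else circlePt (b - min (t - (1 + a + dist (circlePt 0) (circlePt b))) b))
          (S := Set.univ) (Set.mem_univ _) (fun s _ t _ => ?_)
          (fun s t => ?_) ?_ s (Set.mem_univ _) t (Set.mem_univ _)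
        · refine (dist_circlePt_le _ _).trans_eq ?_
          congr 1
          ring
        · refine dist_le_abs_of_glue
            (fun t => walk (circlePt 0) (circlePt b) (t - (1 + a)))
            (fun t => circlePt (b - min (t - (1 + a + dist (circlePt 0) (circlePt b))) b))
            (S := Set.univ) (Set.mem_univ _) (fun s _ t _ => ?_)
            (fun s t => ?_) ?_ s (Set.mem_univ _) t (Set.mem_univ _)
          · exact (dist_walk_le _ _ _ _).trans_eq (hsub _ _ _)
          · refine (dist_circlePt_le _ _).trans ?_
            rw [sub_sub_sub_cancel_left, abs_sub_comm]
            refine (abs_min_sub_min_le_max _ _ _ _).trans ?_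
            rw [sub_self, abs_zero, max_eq_left (abs_nonneg _), hsub]
          · rw [add_sub_cancel_left, walk_of_dist_le le_rfl, sub_self, min_eq_left hb, sub_zero]
        · rw [if_pos (by linarith [dist_nonneg (x := circlePt 0) (y := circlePt b)]), sub_self,
            walk_zero]
          congr 1
          ring
      · rw [if_pos (by linarith), walk_of_dist_le (dist_zero_circlePt _).le]
        simp

theorem dist_zero_chord (hb : 0 ≤ b) (hb' : b ≤ 2 * Real.pi) :
    dist (circlePt 0) (circlePt b) = 2 * Real.sin (b / 2) := by
  rw [dist_comm, dist_circlePt, sub_zero, abs_of_nonneg]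
  exact Real.sin_nonneg_of_nonneg_of_le_pi (by linarith) (by linarith)

theorem detourPath₀_arc {s : ℝ} (hs : 0 ≤ s) (hs' : s ≤ 2 * Real.pi - a - b) :
    detourPath₀ a b (1 + s) = circlePt (-a - s) := by
  rcases eq_or_lt_of_le hs with rfl | hs
  · rw [detourPath₀, if_pos (by linarith), walk_of_dist_le (by rw [dist_zero_circlePt]; linarith)]
    simp
  · rw [detourPath₀, if_neg (by linarith), if_pos (by linarith)]
    congr 1; ring

theorem detourPath₁_arc {s : ℝ} (hs : 0 ≤ s) (hs' : s ≤ a) :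
    detourPath₁ a b (1 + s) = circlePt (-a + s) := by
  rcases eq_or_lt_of_le hs with rfl | hs
  · rw [detourPath₁, if_pos (by linarith), walk_of_dist_le (by rw [dist_zero_circlePt]; linarith)]
    simp
  · rw [detourPath₁, if_neg (by linarith), if_pos (by linarith)]
    congr 1; ring

theorem detourPath₁_chord (ha : 0 ≤ a) {t : ℝ} (ht : 0 ≤ t)
    (ht' : t ≤ dist (circlePt 0) (circlePt b)) :
    detourPath₁ a b (1 + a + t) = walk (circlePt 0) (circlePt b) t := by
  rcases eq_or_lt_of_le ht with rfl | ht
  · rw [add_zero, detourPath₁_arc ha le_rfl, walk_zero, neg_add_cancel]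
  · rw [detourPath₁, if_neg (by linarith), if_neg (by linarith), if_pos (by linarith)]
    congr 1; ring

theorem detourPath₁_return (ha : 0 ≤ a) {r : ℝ} (hr : 0 ≤ r) (hr' : r ≤ b) :
    detourPath₁ a b (1 + a + dist (circlePt 0) (circlePt b) + r) = circlePt (b - r) := by
  have hd := dist_nonneg (x := circlePt 0) (y := circlePt b)
  rcases eq_or_lt_of_le hr with rfl | hr
  · rw [add_zero, detourPath₁_chord ha hd le_rfl, walk_of_dist_le le_rfl, sub_zero]
  · rw [detourPath₁, if_neg (by linarith), if_neg (by linarith), if_neg (by linarith),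
      add_sub_cancel_left, min_eq_left hr']

theorem detourPath₀_end (hab : a + b ≤ 2 * Real.pi) :
    detourPath₀ a b (1 + (2 * Real.pi - a - b) + dist (circlePt 0) (circlePt b)) =
      circlePt 0 := by
  have hd := dist_nonneg (x := circlePt 0) (y := circlePt b)
  rcases eq_or_lt_of_le hd with h | h
  · rw [← h, add_zero, detourPath₀_arc (by linarith) le_rfl, dist_eq_zero.mp h.symm,
      ← circlePt_sub_two_pi b]
    congr 1; ring
  · rw [detourPath₀, if_neg (by linarith), if_neg (by linarith), add_sub_cancel_left,
      walk_of_dist_le (by rw [dist_comm])]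

end Detour

/-! ### The search cost of a detour algorithm, arc by arc. -/

theorem cost_respond_le {p : Fin 2 → ℝ → Plane} (hp : IsTrajectoryPair p) {w C : ℝ} (hw : 0 ≤ w)
    (I : disk) {t : ℝ} (ht : 0 ≤ t) {j : Fin 2} (h : p j t = I) {D₀ D₁ : ℝ}
    (h₀ : dist (p 0 t) I ≤ D₀) (h₁ : dist (p 1 t) I ≤ D₁)
    (hC : w * (t + D₀) + (t + D₁) ≤ C * (w + 1)) :
    weightedCost w (termTime (fun I : disk => respond p I) 0 I)
      (termTime (fun I : disk => respond p I) 1 I) / weightedCost w ‖(I : Plane)‖ₑ ‖(I : Plane)‖ₑ ≤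
      ENNReal.ofReal C := by
  have hw1 : 0 < w + 1 := by linarith
  have hD₀ : 0 ≤ D₀ := dist_nonneg.trans h₀
  have hD₁ : 0 ≤ D₁ := dist_nonneg.trans h₁
  have hC0 : 0 ≤ C := by
    by_contra hneg
    have h2 : C * (w + 1) < 0 := mul_neg_of_neg_of_pos (not_le.mp hneg) hw1
    have h3 : 0 ≤ w * (t + D₀) + (t + D₁) := by positivity
    linarith
  rw [weightedCost_one hw]
  refine ENNReal.div_le_of_le_mul ?_
  rw [← ENNReal.ofReal_mul hC0]
  refine (weightedCost_mono (termTime_respond_le hp I ht h 0)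
    (termTime_respond_le hp I ht h 1)).trans ?_
  rw [weightedCost_ofReal hw (by positivity) (by positivity)]
  refine ENNReal.ofReal_le_ofReal (le_trans ?_ hC)
  gcongr

theorem exists_circlePt_eq (c : ℝ) (I : disk) :
    ∃ θ, c < θ ∧ θ ≤ c + 2 * Real.pi ∧ (I : Plane) = circlePt θ := by
  have hI : (I : Plane) ∈ Metric.sphere 0 1 := I.2
  rw [mem_sphere_zero_iff_norm, EuclideanSpace.norm_eq, Real.sqrt_eq_one, Fin.sum_univ_two] at hI
  simp only [Real.norm_eq_abs, sq_abs] at hI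
  set z : ℂ := ⟨(I : Plane) 0, (I : Plane) 1⟩ with hz
  have hnz : ‖z‖ = 1 := by
    rw [Complex.norm_def, Real.sqrt_eq_one, Complex.normSq_apply]
    linarith
  have hz0 : z ≠ 0 := by
    intro h
    rw [h] at hnz
    simp at hnz
  set θ := toIocMod Real.two_pi_pos c z.arg with hθ
  have hmem := toIocMod_mem_Ioc Real.two_pi_pos c z.arg
  have hθ' : θ = z.arg - toIocDiv Real.two_pi_pos c z.arg • (2 * Real.pi) := by
    rw [hθ, ← self_sub_toIocDiv_zsmul]
  refine ⟨θ, hmem.1, hmem.2, ?_⟩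
  have hcos : Real.cos θ = z.re := by
    rw [hθ', zsmul_eq_mul, Real.cos_sub_int_mul_two_pi, Complex.cos_arg hz0, hnz, div_one]
  have hsin : Real.sin θ = z.im := by
    rw [hθ', zsmul_eq_mul, Real.sin_sub_int_mul_two_pi, Complex.sin_arg, hnz, div_one]
  ext i
  fin_cases i
  · simp [circlePt, hcos, hz]
  · simp [circlePt, hsin, hz]

section Detour

variable {a b w : ℝ}

theorem detour_eq_respond :
    detour a b = fun I : disk => respond ![detourPath₀ a b, detourPath₁ a b] I := rfl

/-- The search cost of a Detour Algorithm is bounded by its cost on the four arcs on which the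
target may lie. -/
theorem searchCost_detour_le {C : ℝ} (hw : 0 ≤ w) (hw1 : w ≤ 1) (ha : 0 ≤ a) (hb : 0 ≤ b)
    (hab : a + b ≤ Real.pi) (hret : 2 * Real.pi - a - b ≤ a + 2 * Real.sin (b / 2) + b)
    (hA : ∀ s, 0 ≤ s → s ≤ a → 1 + s + 2 * Real.sin s / (w + 1) ≤ C)
    (hchord : ∀ t, 0 ≤ t → t ≤ 2 * Real.sin (b / 2) →
      1 + a + t + dist (walk (circlePt 0) (circlePt b) t) (circlePt (-a - (a + t))) / (w + 1) ≤ C)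
    (hγ₂ : 1 + (2 * Real.pi - a - b) + 2 * |Real.sin (a + b / 2 + Real.sin (b / 2))| / (w + 1) ≤ C)
    (hγ₃ : 1 + γ₃ w a b ≤ C) :
    searchCost (weightedCost w) (detour a b) ≤ ENNReal.ofReal C := by
  have hw0 : 0 < w + 1 := by linarith
  have hp := isTrajectoryPair_detour ha hb (by linarith [Real.pi_pos] : a + b ≤ 2 * Real.pi)
  rw [detour_eq_respond]
  set p : Fin 2 → ℝ → Plane := ![detourPath₀ a b, detourPath₁ a b] with hpdef
  have hp0 : p 0 = detourPath₀ a b := rfl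
  have hp1 : p 1 = detourPath₁ a b := rfl
  have hL : dist (circlePt 0) (circlePt b) = 2 * Real.sin (b / 2) :=
    dist_zero_chord hb (by linarith [Real.pi_pos])
  have hs0 : 0 ≤ Real.sin (b / 2) :=
    Real.sin_nonneg_of_nonneg_of_le_pi (by linarith) (by linarith)
  refine iSup_le fun I => ?_
  obtain ⟨θ, hθ1, hθ2, hI⟩ := exists_circlePt_eq (b - 2 * Real.pi) I
  rcases le_or_gt 0 θ with h0 | h0
  · -- the arc from `c(0)` to `c(b)`
    obtain ⟨r, rfl⟩ : ∃ r, θ = b - r := ⟨b - θ, by ring⟩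
    have hvis : p 1 (1 + a + 2 * Real.sin (b / 2) + r) = I := by
      rw [hp1, ← hL, detourPath₁_return ha (by linarith) (by linarith), hI]
    have ht : 0 ≤ 1 + a + 2 * Real.sin (b / 2) + r := by linarith
    refine cost_respond_le hp hw I ht hvis
      -- `A₀` is still on its way to `c(0)`: its distance to `c(0)` is at most the remaining time of
      -- its path, and the arc from `c(0)` to the target is added.
      (D₀ := (1 + (2 * Real.pi - a - b) + 2 * Real.sin (b / 2) -
        (1 + a + 2 * Real.sin (b / 2) + r)) + (b - r)) (D₁ := 0) ?_ ?_ ?_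
    · refine (dist_triangle _ (circlePt 0) _).trans (add_le_add ?_ ?_)
      · have hend := detourPath₀_end (a := a) (b := b) (by linarith [Real.pi_pos])
        rw [← hend, hL, ← hp0]
        refine (hp.speed 0 _ ht _ (Set.mem_Ici.mpr (by linarith))).trans ?_
        rw [abs_of_nonpos (by linarith)]
        linarith
      · rw [hI]
        refine (dist_circlePt_le _ _).trans ?_
        rw [abs_of_nonpos (by linarith)]
        linarith
    · rw [hvis, dist_self]
    -- The resulting bound is affine in `r` with slope `1 - w ≥ 0`, so the worst case is `r = b`,
    -- which is `1 + γ₃`.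
    · have h3 : (1 + γ₃ w a b) * (w + 1) =
          (1 + 2 * Real.sin (b / 2)) * (w + 1) + (a + b + w * (-a - b + 2 * Real.pi)) := by
        rw [γ₃]
        field_simp
        ring
      have h4 := mul_le_mul_of_nonneg_right hγ₃ hw0.le
      rw [h3] at h4
      nlinarith
  rcases le_or_gt (-a) θ with h1 | h1
  · -- the arc explored by the second agent alone
    obtain ⟨s, rfl⟩ : ∃ s, θ = -a + s := ⟨θ + a, by ring⟩
    have hvis : p 1 (1 + s) = I := by
      rw [hp1, detourPath₁_arc (by linarith) (by linarith), hI]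
    have hsin : 0 ≤ Real.sin s :=
      Real.sin_nonneg_of_nonneg_of_le_pi (by linarith) (by linarith)
    refine cost_respond_le hp hw I (by linarith) hvis (D₀ := 2 * Real.sin s) (D₁ := 0) ?_ ?_ ?_
    · rw [hp0, detourPath₀_arc (by linarith) (by linarith), hI, dist_circlePt,
        show (-a - s - (-a + s)) / 2 = -s by ring, Real.sin_neg, abs_neg, abs_of_nonneg hsin]
    · rw [hvis, dist_self]
    · have h4 := mul_le_mul_of_nonneg_right (hA s (by linarith) (by linarith)) hw0.le
      rw [add_mul, div_mul_cancel₀ _ hw0.ne'] at h4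
      nlinarith
  obtain ⟨s, rfl⟩ : ∃ s, θ = -a - s := ⟨-a - θ, by ring⟩
  have hvis : p 0 (1 + s) = I := by
    rw [hp0, detourPath₀_arc (by linarith) (by linarith), hI]
  have hd0 : dist (p 0 (1 + s)) I ≤ 0 := by rw [hvis, dist_self]
  rcases le_or_gt s a with h2 | h2
  · have hsin : 0 ≤ Real.sin s :=
      Real.sin_nonneg_of_nonneg_of_le_pi (by linarith) (by linarith)
    refine cost_respond_le hp hw I (by linarith) hvis (D₁ := 2 * Real.sin s) hd0 ?_ ?_
    · rw [hp1, detourPath₁_arc (by linarith) (by linarith), hI, dist_circlePt,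
        show (-a + s - (-a - s)) / 2 = s by ring, abs_of_nonneg hsin]
    · have h4 := mul_le_mul_of_nonneg_right (hA s (by linarith) (by linarith)) hw0.le
      rw [add_mul, div_mul_cancel₀ _ hw0.ne'] at h4
      linarith
  rcases le_or_gt s (a + 2 * Real.sin (b / 2)) with h3 | h3
  · -- the second agent is on the chord
    obtain ⟨t, rfl⟩ : ∃ t, s = a + t := ⟨s - a, by ring⟩
    refine cost_respond_le hp hw I (by linarith) hvis hd0 le_rfl ?_
    have h4 := mul_le_mul_of_nonneg_right (hchord t (by linarith) (by linarith)) hw0.le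
    rw [add_mul, div_mul_cancel₀ _ hw0.ne'] at h4
    rw [hp1, show 1 + (a + t) = 1 + a + t by ring,
      detourPath₁_chord ha (by linarith) (by linarith), hI]
    linarith
  · -- the second agent is on its way back to `c(0)`
    obtain ⟨r, rfl⟩ : ∃ r, s = a + 2 * Real.sin (b / 2) + r :=
      ⟨s - (a + 2 * Real.sin (b / 2)), by ring⟩
    -- Both agents now move clockwise, so their distance is constant and the last target of this
    -- phase is the worst. The hypothesis `hret` keeps `A₁` on its return arc until `A₀` reaches
    -- `c(b)`.
    refine cost_respond_le hp hw I (by linarith) hvis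
      (D₁ := 2 * |Real.sin (a + b / 2 + Real.sin (b / 2))|) hd0 ?_ ?_
    · rw [hp1, show 1 + (a + 2 * Real.sin (b / 2) + r) =
          1 + a + dist (circlePt 0) (circlePt b) + r by rw [hL]; ring,
        detourPath₁_return ha (by linarith) (by linarith), hI, dist_circlePt]
      apply le_of_eq
      congr 3
      ring
    · have h4 := mul_le_mul_of_nonneg_right hγ₂ hw0.le
      rw [add_mul, div_mul_cancel₀ _ hw0.ne'] at h4
      nlinarith

theorem termTime_detour_ne_top (ha : 0 ≤ a) (hb : 0 ≤ b) (hab : a + b ≤ 2 * Real.pi) (I : disk)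
    (i : Fin 2) : termTime (detour a b) i I ≠ ⊤ := by
  have hp := isTrajectoryPair_detour ha hb hab
  obtain ⟨θ, hθ1, hθ2, hI⟩ := exists_circlePt_eq (b - 2 * Real.pi) I
  suffices h : ∃ t, 0 ≤ t ∧ ∃ j, (![detourPath₀ a b, detourPath₁ a b] : Fin 2 → ℝ → Plane) j t = I by
    obtain ⟨t, ht, j, hj⟩ := h
    rw [detour_eq_respond]
    exact ne_top_of_le_ne_top ENNReal.ofReal_ne_top (termTime_respond_le hp I ht hj i)
  rcases le_or_gt θ (-a) with h1 | h1
  · refine ⟨1 + (-a - θ), by linarith, 0, ?_⟩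
    rw [hI]
    refine (detourPath₀_arc (by linarith) (by linarith)).trans ?_
    congr 1; ring
  rcases le_or_gt θ 0 with h0 | h0
  · refine ⟨1 + (θ + a), by linarith, 1, ?_⟩
    rw [hI]
    refine (detourPath₁_arc (by linarith) (by linarith)).trans ?_
    congr 1; ring
  · have hd := dist_nonneg (x := circlePt 0) (y := circlePt b)
    refine ⟨1 + a + dist (circlePt 0) (circlePt b) + (b - θ), by linarith, 1, ?_⟩
    rw [hI]
    refine (detourPath₁_return ha (by linarith) (by linarith)).trans ?_
    congr 1; ring

/-- The witness is `c(-a-d)`: `A₀` finds it at time `1 + d`, when `A₁` is at the mirror point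
`c(-a+d)`. Between times `1` and `1 + d` both agents are on the circle and away from the target, so
this is the first visit. -/
theorem le_searchCost_detour {d : ℝ} (hw : 0 ≤ w) (ha : 0 ≤ a) (hb : 0 ≤ b) (hd : 0 ≤ d)
    (hda : d ≤ a) (hdπ : d ≤ Real.pi) (hdb : d ≤ 2 * Real.pi - a - b) :
    ENNReal.ofReal (1 + d + 2 * Real.sin d / (w + 1)) ≤
      searchCost (weightedCost w) (detour a b) := by
  have hw0 : 0 < w + 1 := by linarith
  have hp := isTrajectoryPair_detour ha hb (by linarith : a + b ≤ 2 * Real.pi)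
  rw [detour_eq_respond]
  set p : Fin 2 → ℝ → Plane := ![detourPath₀ a b, detourPath₁ a b] with hpdef
  have hp0 : p 0 = detourPath₀ a b := rfl
  have hp1 : p 1 = detourPath₁ a b := rfl
  have hsin : 0 ≤ Real.sin d := Real.sin_nonneg_of_nonneg_of_le_pi hd hdπ
  set I : disk := circleTarget (-a - d) with hIdef
  have hI : (I : Plane) = circlePt (-a - d) := rfl
  have hvis : p 0 (1 + d) = I := by rw [hp0, detourPath₀_arc hd hdb, hI]
  have hfirst : ∀ t, 0 ≤ t → ∀ i, p i t = I → 1 + d ≤ t := by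
    intro t ht i hit
    have h1 : 1 ≤ t := by
      have := hp.speed i 0 (Set.mem_Ici.mpr le_rfl) t ht
      rw [hp.start, hit, hI, dist_zero_circlePt, zero_sub, abs_neg, abs_of_nonneg ht] at this
      exact this
    by_contra hlt
    push Not at hlt
    obtain ⟨s, rfl⟩ : ∃ s, t = 1 + s := ⟨t - 1, by ring⟩
    rw [← dist_eq_zero] at hit
    have key : ∀ z, 0 < z → z < Real.pi → 2 * |Real.sin z| ≠ 0 := by
      intro z h0 hπ
      have := Real.sin_pos_of_pos_of_lt_pi h0 hπ
      have := abs_pos.mpr this.ne'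
      linarith
    fin_cases i
    · simp only [Fin.zero_eta] at hit
      rw [hp0, detourPath₀_arc (by linarith) (by linarith), hI, dist_circlePt] at hit
      exact key _ (by linarith) (by linarith) hit
    · simp only [Fin.mk_one] at hit
      rw [hp1, detourPath₁_arc (by linarith) (by linarith), hI, dist_circlePt] at hit
      exact key _ (by linarith) (by linarith) hit
  refine le_trans ?_ (le_iSup _ I)
  have h0 := le_termTime_respond hp I (by linarith) hvis hfirst 0
  have h1 := le_termTime_respond hp I (by linarith) hvis hfirst 1
  rw [hvis, dist_self, add_zero] at h0
  rw [hp1, detourPath₁_arc hd hda, hI, dist_circlePt,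
    show (-a + d - (-a - d)) / 2 = d by ring, abs_of_nonneg hsin] at h1
  rw [weightedCost_one hw, ENNReal.le_div_iff_mul_le
    (Or.inl (by simpa using hw0)) (Or.inl ENNReal.ofReal_ne_top),
    ← ENNReal.ofReal_mul (by positivity),
    show (1 + d + 2 * Real.sin d / (w + 1)) * (w + 1) = w * (1 + d) + (1 + d + 2 * Real.sin d) by
      field_simp; ring,
    ← weightedCost_ofReal hw (by linarith) (by linarith)]
  exact weightedCost_mono h0 h1

end Detour

/-! ### The nonlinear system: location and uniqueness of its root. -/

open Real Set

/-- Difference `(γ₁ - γ₃) / 2` in the variables `k = 1 / (w + 1)`, `x = π - α`, `y = β / 2`. -/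
noncomputable def detourEq₁ (k x y : ℝ) : ℝ := k * sin x - (1 - k) * x - sin y - (2 * k - 1) * y

/-- Difference `(γ₁ - γ₂) / 2` in the variables `k = 1 / (w + 1)`, `x = π - α`, `y = β / 2`. -/
noncomputable def detourEq₂ (k x y : ℝ) : ℝ := k * sin x - x + y - k * sin (x - y - sin y)

theorem γ₁_sub_γ₃ {w : ℝ} (hw : 0 ≤ w) (x y : ℝ) :
    γ₁ w (π - x) - γ₃ w (π - x) (2 * y) = 2 * detourEq₁ (1 / (w + 1)) x y := by
  have h : w + 1 ≠ 0 := by linarith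
  rw [γ₁, γ₃, detourEq₁, sin_pi_sub, mul_div_cancel_left₀ y two_ne_zero]
  field_simp
  ring

theorem γ₁_sub_γ₂ {w : ℝ} (x y : ℝ) :
    γ₁ w (π - x) - γ₂ w (π - x) (2 * y) = 2 * detourEq₂ (1 / (w + 1)) x y := by
  rw [γ₁, γ₂, detourEq₂, sin_pi_sub, mul_div_cancel_left₀ y two_ne_zero,
    show π - x + y + sin y = π - (x - y - sin y) by ring, sin_pi_sub]
  ring

theorem isDetourSolution_iff {w : ℝ} (hw : 0 ≤ w) (x y : ℝ) :
    IsDetourSolution w (π - x) (2 * y) ↔ x ≤ π ∧ 0 < y ∧ 2 * y ≤ π + x ∧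
      detourEq₁ (1 / (w + 1)) x y = 0 ∧ detourEq₂ (1 / (w + 1)) x y = 0 := by
  have h1 := γ₁_sub_γ₃ hw x y
  have h2 := γ₁_sub_γ₂ (w := w) x y
  constructor
  · intro h
    have e1 := h.eq₁₂
    have e2 := h.eq₂₃
    exact ⟨by linarith [h.nonneg], by linarith [h.pos], by linarith [h.le], by linarith,
      by linarith⟩
  · rintro ⟨a1, a2, a3, a4, a5⟩
    exact ⟨by linarith, by linarith, by linarith, by linarith, by linarith⟩

theorem sin_mul_le_mul_sin {L t : ℝ} (hL : 1 ≤ L) (ht : 0 ≤ t) (hLt : L * t ≤ π) :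
    sin (L * t) ≤ L * sin t := by
  have hL0 : 0 < L := by linarith
  have h := strictConcaveOn_sin_Icc.concaveOn.2 (⟨by positivity, hLt⟩ : L * t ∈ Icc 0 π)
    (⟨le_rfl, pi_pos.le⟩ : (0 : ℝ) ∈ Icc 0 π) (by positivity : 0 ≤ 1 / L)
    (by rw [sub_nonneg, div_le_one hL0]; exact hL : 0 ≤ 1 - 1 / L) (by ring)
  simp only [smul_eq_mul, mul_zero, add_zero, sin_zero] at h
  rw [← mul_assoc, one_div, inv_mul_cancel₀ hL0.ne', one_mul] at h
  rwa [inv_mul_le_iff₀ hL0] at h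

theorem sin_mul_lt_mul_sin {L t : ℝ} (hL : 1 < L) (ht : 0 < t) (hLt : L * t ≤ π) :
    sin (L * t) < L * sin t := by
  have hL0 : 0 < L := by linarith
  have h := strictConcaveOn_sin_Icc.2 (⟨by positivity, hLt⟩ : L * t ∈ Icc 0 π)
    (⟨le_rfl, pi_pos.le⟩ : (0 : ℝ) ∈ Icc 0 π) (by positivity) (by positivity : 0 < 1 / L)
    (by rw [sub_pos, div_lt_one hL0]; exact hL : 0 < 1 - 1 / L) (by ring)
  simp only [smul_eq_mul, mul_zero, add_zero, sin_zero] at h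
  rw [← mul_assoc, one_div, inv_mul_cancel₀ hL0.ne', one_mul] at h
  rwa [inv_mul_lt_iff₀ hL0] at h

/-- At `y = x/2` the linear terms of `E₁` add up to `-x/2`, so this says `E₁(x, x/2) < 0`. It holds
because `sin x = 2 sin(x/2) cos(x/2) < 2 sin(x/2) < sin(x/2) + x/2`. -/
theorem mul_sin_lt_of_pos {k x : ℝ} (hk1 : k ≤ 1) (hx : 0 < x) (hxπ : x ≤ π) :
    k * sin x < sin (x / 2) + x / 2 := by
  have hs : 0 < sin (x / 2) := sin_pos_of_pos_of_lt_pi (by linarith) (by linarith [pi_pos])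
  have hc : cos (x / 2) < 1 := by
    rw [← cos_zero]
    exact cos_lt_cos_of_nonneg_of_le_pi le_rfl (by linarith [pi_pos]) (by linarith)
  have hs2 : sin (x / 2) < x / 2 := sin_lt (by linarith)
  have hsx : 0 ≤ sin x := sin_nonneg_of_nonneg_of_le_pi hx.le hxπ
  have e : sin x = 2 * sin (x / 2) * cos (x / 2) := by
    rw [← sin_two_mul]; congr 1; ring
  nlinarith

theorem half_bound_of_detourEq₁ {k x y : ℝ} (hk : 5 / 6 ≤ k) (hk1 : k ≤ 1) (hx : 0 < x)
    (hxπ : x ≤ π) (hy : 0 < y) (hyπ : y ≤ π) (h₁ : detourEq₁ k x y = 0) : y < x / 2 := by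
  by_contra hlt
  push Not at hlt
  have h := mul_sin_lt_of_pos hk1 hx hxπ
  rw [detourEq₁] at h₁
  rcases le_or_gt y (π / 2) with h2 | h2
  · have h3 : sin (x / 2) ≤ sin y := sin_le_sin_of_le_of_le_pi_div_two (by linarith) h2 hlt
    nlinarith
  · have h3 : 0 ≤ sin y := sin_nonneg_of_nonneg_of_le_pi hy.le hyπ
    have h4 := sin_le_one x
    have h5 := pi_gt_three
    nlinarith

/-- If `E₂ ≥ 0`, then `x - y ≤ k`, so `y ≥ π/2 - k > π/6` and `sin y ≥ 1/2`. The subtracted terms of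
`E₁` then exceed `k ≥ k sin x`. -/
theorem detourEq₂_neg_of_pi_div_two_le {k x y : ℝ} (hk : 5 / 6 ≤ k) (hk1 : k ≤ 1)
    (hx : π / 2 ≤ x) (hxπ : x ≤ π) (hy : 0 < y) (hyx : y < x / 2) (h₁ : detourEq₁ k x y = 0) :
    detourEq₂ k x y < 0 := by
  by_contra h₂
  push Not at h₂
  have hsy : 0 ≤ sin y := sin_nonneg_of_nonneg_of_le_pi hy.le (by linarith)
  have hsy' : sin y < y := sin_lt hy
  have hu : 0 ≤ sin (x - y - sin y) := sin_nonneg_of_nonneg_of_le_pi (by linarith) (by linarith)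
  rw [detourEq₁] at h₁
  rw [detourEq₂] at h₂
  have h3 := sin_le_one x
  have hπ := pi_gt_d2
  have hπ' := pi_lt_d2
  have hy1 : π / 2 - k ≤ y := by nlinarith
  have hs : 1 / 2 ≤ sin y := by
    rw [← sin_pi_div_six]
    exact sin_le_sin_of_le_of_le_pi_div_two (by linarith) (by linarith) (by linarith)
  nlinarith

/-- Every admissible root lies in the region where the monotonicity lemmas apply. For `x = -z ≤ 0`,
the equation `E₂ = 0` forces `z ≤ y`, and then `k sin z ≥ (1-k) z` makes `E₁` negative. -/
theorem apriori_bounds {k x y : ℝ} (hk : 5 / 6 ≤ k) (hk1 : k ≤ 1) (hx : x ≤ π) (hy : 0 < y)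
    (hxy : 2 * y ≤ π + x) (h₁ : detourEq₁ k x y = 0) (h₂ : detourEq₂ k x y = 0) :
    0 < x ∧ x < π / 2 ∧ y < x / 2 := by
  have hyπ : y ≤ π := by linarith
  have hsy : 0 ≤ sin y := sin_nonneg_of_nonneg_of_le_pi hy.le hyπ
  have hsy' : sin y < y := sin_lt hy
  have hx0 : 0 < x := by
    by_contra hneg
    push Not at hneg
    obtain ⟨z, rfl⟩ : ∃ z, x = -z := ⟨-x, by ring⟩
    have hz : 0 ≤ z := by linarith
    rw [detourEq₁, sin_neg] at h₁
    rw [detourEq₂, show -z - y - sin y = -(z + y + sin y) by ring, sin_neg, sin_neg] at h₂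
    have h3 : sin z - sin (z + y + sin y) ≤ y + sin y := by
      have := Real.abs_sin_sub_sin_le z (z + y + sin y)
      rw [show z - (z + y + sin y) = -(y + sin y) by ring, abs_neg,
        abs_of_nonneg (by linarith : 0 ≤ y + sin y)] at this
      exact (le_abs_self _).trans this
    have hzy : z ≤ y := by nlinarith
    have h4 := mul_le_sin hz (by linarith)
    have h5 : z / 2 ≤ 2 / π * z := by
      rw [div_mul_eq_mul_div, div_le_div_iff₀ two_pos pi_pos]
      nlinarith [pi_le_four]
    nlinarith
  have hyx := half_bound_of_detourEq₁ hk hk1 hx0 hx hy hyπ h₁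
  refine ⟨hx0, ?_, hyx⟩
  by_contra hge
  exact (detourEq₂_neg_of_pi_div_two_le hk hk1 (not_lt.mp hge) hx hy hyx h₁).ne h₂

/-- For fixed `x`, the first equation has at most one relevant solution `y`. -/
theorem detourEq₁_strictAnti {k x y y' : ℝ} (hk : 5 / 6 ≤ k) (hy : 0 ≤ y)
    (hy' : y' ≤ π / 2) (h : y < y') : detourEq₁ k x y' < detourEq₁ k x y := by
  have := sin_le_sin_of_le_of_le_pi_div_two (by linarith [pi_pos]) hy' h.le
  simp only [detourEq₁]
  nlinarith

theorem detourEq₂_strictMono {k x y y' : ℝ} (hk : 5 / 6 ≤ k) (hx : x ≤ π / 2) (hy : 0 ≤ y)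
    (hy' : y' ≤ x / 2) (h : y < y') : detourEq₂ k x y < detourEq₂ k x y' := by
  have h1 := sin_le_sin_of_le_of_le_pi_div_two (by linarith [pi_pos]) (by linarith) h.le
  have h2 : sin y' ≤ y' := sin_le (by linarith)
  have h3 : 0 ≤ sin y := sin_nonneg_of_nonneg_of_le_pi hy (by linarith [pi_pos])
  have h4 : sin (x - y' - sin y') ≤ sin (x - y - sin y) :=
    sin_le_sin_of_le_of_le_pi_div_two (by linarith [pi_pos]) (by linarith) (by linarith)
  simp only [detourEq₂]
  nlinarith

/-- The function `t ↦ L sin t - sin (L t)` is convex. -/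
theorem mul_sin_sub_sin_mul_le {L x y : ℝ} (hL : 1 ≤ L) (hy : 0 ≤ y) (hyx : y ≤ x) (hx : 0 < x)
    (hLx : L * x ≤ π / 2) :
    L * sin y - sin (L * y) ≤ y / x * (L * sin x - sin (L * x)) := by
  have hL0 : 0 < L := by linarith
  have hd : ∀ t, HasDerivAt (fun t => L * sin t - sin (L * t)) (L * cos t - cos (L * t) * L) t := by
    intro t
    have h1 := (hasDerivAt_sin t).const_mul L
    have h2 := ((hasDerivAt_id t).const_mul L).sin
    simpa using h1.fun_sub h2
  have hconv : ConvexOn ℝ (Icc 0 x) fun t => L * sin t - sin (L * t) := by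
    refine MonotoneOn.convexOn_of_deriv (convex_Icc 0 x)
      (fun t _ => (hd t).continuousAt.continuousWithinAt)
      (fun t _ => (hd t).differentiableAt.differentiableWithinAt) ?_
    refine monotoneOn_of_deriv_nonneg (convex_Icc 0 x |>.interior) ?_ ?_ ?_
    · rw [funext fun t => (hd t).deriv]
      fun_prop
    · rw [funext fun t => (hd t).deriv]
      fun_prop
    · intro t ht
      rw [interior_interior, interior_Icc] at ht
      rw [funext fun t => (hd t).deriv]
      have h1 := (hasDerivAt_cos t).const_mul L
      have h2 := (((hasDerivAt_id t).const_mul L).cos).mul_const L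
      have h3 : HasDerivAt (fun t => L * cos t - cos (L * t) * L)
          (L * -sin t - -sin (L * t) * (L * 1) * L) t := by
        simpa using h1.fun_sub h2
      rw [h3.deriv]
      -- The second derivative is `L (L sin(Lt) - sin t)`, nonnegative since `t ≤ Lt ≤ π/2` and `L ≥
      -- 1`.
      have h4 : sin t ≤ sin (L * t) := by
        apply sin_le_sin_of_le_of_le_pi_div_two <;> nlinarith [ht.1, ht.2, pi_pos]
      have h5 : 0 ≤ sin t :=
        sin_nonneg_of_nonneg_of_le_pi ht.1.le (by nlinarith [ht.1, ht.2, pi_pos])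
      have h6 : sin t ≤ L * sin (L * t) := by nlinarith
      nlinarith
  have h := hconv.2 (⟨hx.le, le_rfl⟩ : x ∈ Icc 0 x) (⟨le_rfl, hx.le⟩ : (0 : ℝ) ∈ Icc 0 x)
    (by positivity : 0 ≤ y / x) (by rw [sub_nonneg, div_le_one hx]; exact hyx : 0 ≤ 1 - y / x)
    (by ring)
  simpa [div_mul_cancel₀ y hx.ne'] using h

/-- Along the solutions of the first equation, the ratio `y / x` is decreasing. -/
theorem ratio_lt_of_detourEq₁ {k x₁ y₁ x₂ y₂ : ℝ} (hk : 5 / 6 ≤ k) (hx₁ : 0 < x₁) (hx : x₁ < x₂)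
    (hx₂ : x₂ ≤ π / 2) (hy₁ : 0 < y₁) (hy₁' : y₁ < x₁ / 2) (hy₂' : y₂ < x₂ / 2)
    (h₁ : detourEq₁ k x₁ y₁ = 0) (h₂ : detourEq₁ k x₂ y₂ = 0) : y₂ < x₂ / x₁ * y₁ := by
  by_contra hge
  push Not at hge
  obtain ⟨L, hL⟩ : ∃ L, L = x₂ / x₁ := ⟨_, rfl⟩
  rw [← hL] at hge
  have hx₂' : x₂ = L * x₁ := by rw [hL]; field_simp
  have hL1 : 1 < L := by rw [hL, one_lt_div hx₁]; exact hx
  have hLy : 0 < L * y₁ := by positivity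
  have h3 := mul_sin_sub_sin_mul_le hL1.le hy₁.le (by linarith : y₁ ≤ x₁) hx₁ (by linarith)
  have h4 := sin_mul_lt_mul_sin hL1 hx₁ (by linarith [pi_pos])
  have h5 : y₁ / x₁ ≤ 1 / 2 := by rw [div_le_div_iff₀ hx₁ two_pos]; linarith
  have h6 : sin (L * y₁) ≤ sin y₂ :=
    sin_le_sin_of_le_of_le_pi_div_two (by linarith [pi_pos]) (by linarith) hge
  rw [hx₂'] at h₂
  simp only [detourEq₁] at h₁ h₂
  set D := L * sin x₁ - sin (L * x₁) with hD
  have hD0 : 0 < D := by linarith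
  have h7 : L * sin y₁ - sin (L * y₁) ≤ 1 / 2 * D :=
    h3.trans (mul_le_mul_of_nonneg_right h5 hD0.le)
  -- `L` times the first equation at `x₁` minus the one at `x₂`: the terms in `x` cancel. With the
  -- previous bound `k D ≤ D/2`, which is impossible as `k > 1/2` and `D > 0`.
  have h8 : k * D ≤ L * sin y₁ - sin (L * y₁) := by
    have e : k * D = L * (k * sin x₁) - k * sin (L * x₁) := by rw [hD]; ring
    have e1 : L * (k * sin x₁) = L * ((1 - k) * x₁ + sin y₁ + (2 * k - 1) * y₁) := by
      congr 1; linarith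
    have h9 : (2 * k - 1) * (L * y₁) ≤ (2 * k - 1) * y₂ :=
      mul_le_mul_of_nonneg_left hge (by linarith)
    rw [e, e1]
    linarith
  nlinarith

/-- Along the solutions of the first equation, the second function changes its sign only once. -/
theorem detourEq₂_neg_of_lt {k x₁ y₁ x₂ y₂ : ℝ} (hk : 5 / 6 ≤ k) (hx₁ : 0 < x₁) (hx : x₁ < x₂)
    (hx₂ : x₂ ≤ π / 2) (hy₁ : 0 < y₁) (hy₁' : y₁ < x₁ / 2) (hy₂ : 0 < y₂) (hy₂' : y₂ < x₂ / 2)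
    (h₁ : detourEq₁ k x₁ y₁ = 0) (h₂ : detourEq₁ k x₂ y₂ = 0) (h : detourEq₂ k x₁ y₁ ≤ 0) :
    detourEq₂ k x₂ y₂ < 0 := by
  have hlt := ratio_lt_of_detourEq₁ hk hx₁ hx hx₂ hy₁ hy₁' hy₂' h₁ h₂
  obtain ⟨L, hL⟩ : ∃ L, L = x₂ / x₁ := ⟨_, rfl⟩
  rw [← hL] at hlt
  have hx₂e : x₂ = L * x₁ := by rw [hL]; field_simp
  have hL1 : 1 < L := by rw [hL, one_lt_div hx₁]; exact hx
  have hLy : L * y₁ < x₂ / 2 := by rw [hx₂e]; nlinarith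
  have hLy0 : y₁ < L * y₁ := by nlinarith
  -- As `E₂` increases in `y`, it suffices to treat the scaled point `(L x₁, L y₁)`, where `E₂` is
  -- at most `L E₂(x₁, y₁) ≤ 0`.
  refine (detourEq₂_strictMono hk hx₂ hy₂.le hLy.le hlt).trans_le ?_
  -- In product form, scaling by `L` multiplies the sine factor by at most `L` and does not increase
  -- the cosine factor.
  have hform : ∀ x y, detourEq₂ k x y =
      2 * k * (sin ((y + sin y) / 2) * cos (x - (y + sin y) / 2)) - x + y := by
    intro x y
    have := sin_sub_sin x (x - y - sin y)
    rw [show (x - (x - y - sin y)) / 2 = (y + sin y) / 2 by ring,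
      show (x + (x - y - sin y)) / 2 = x - (y + sin y) / 2 by ring] at this
    rw [detourEq₂]
    linear_combination k * this
  rw [hform] at h ⊢
  have hsy₁ : 0 ≤ sin y₁ := sin_nonneg_of_nonneg_of_le_pi hy₁.le (by linarith [pi_pos])
  have hsy₁' : sin y₁ ≤ y₁ := sin_le hy₁.le
  have hsL : sin (L * y₁) ≤ L * sin y₁ := sin_mul_le_mul_sin hL1.le hy₁.le (by linarith [pi_pos])
  have hsL' : sin y₁ ≤ sin (L * y₁) :=
    sin_le_sin_of_le_of_le_pi_div_two (by linarith [pi_pos]) (by linarith) hLy0.le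
  have hsd : sin (L * y₁) - sin y₁ ≤ L * y₁ - y₁ := by
    have := Real.abs_sin_sub_sin_le (L * y₁) y₁
    rw [abs_of_nonneg (by linarith : 0 ≤ L * y₁ - y₁)] at this
    exact (le_abs_self _).trans this
  set p := (y₁ + sin y₁) / 2 with hp
  set q := (L * y₁ + sin (L * y₁)) / 2 with hq
  have hqp : q ≤ L * p := by rw [hq, hp]; linarith
  have hpq : p ≤ q := by rw [hq, hp]; linarith
  have hLp : L * p ≤ L * y₁ := mul_le_mul_of_nonneg_left (by linarith) (by linarith)
  have hqd : q - p ≤ x₂ - x₁ := by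
    have : L * y₁ - y₁ ≤ x₂ - x₁ := by rw [hx₂e]; nlinarith
    rw [hq, hp]; linarith
  have hs1 : sin q ≤ L * sin p :=
    (sin_le_sin_of_le_of_le_pi_div_two (by linarith) (by linarith) hqp).trans
      (sin_mul_le_mul_sin hL1.le (by linarith) (by linarith [pi_pos]))
  have hsp : 0 ≤ sin p := sin_nonneg_of_nonneg_of_le_pi (by linarith) (by linarith [pi_pos])
  have hc1 : cos (x₂ - q) ≤ cos (x₁ - p) :=
    cos_le_cos_of_nonneg_of_le_pi (by linarith) (by linarith) (by linarith)
  have hc0 : 0 ≤ cos (x₂ - q) := cos_nonneg_of_neg_pi_div_two_le_of_le (by linarith) (by linarith)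
  have hmul : sin q * cos (x₂ - q) ≤ L * sin p * cos (x₁ - p) :=
    mul_le_mul hs1 hc1 hc0 (by positivity)
  calc 2 * k * (sin q * cos (x₂ - q)) - x₂ + L * y₁
      ≤ 2 * k * (L * sin p * cos (x₁ - p)) - x₂ + L * y₁ := by gcongr
    _ = L * (2 * k * (sin p * cos (x₁ - p)) - x₁ + y₁) := by rw [hx₂e]; ring
    _ ≤ 0 := mul_nonpos_of_nonneg_of_nonpos (by linarith) h

/-! ### Intermediate values along the first equation. -/

theorem detourEq₁_zero_pos {k x : ℝ} (hk : 5 / 6 ≤ k) (hx : 0 < x) (hx' : x ≤ π / 2) :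
    0 < detourEq₁ k x 0 := by
  have h4 := mul_le_sin hx.le hx'
  have h5 : x / 2 ≤ 2 / π * x := by
    rw [div_mul_eq_mul_div, div_le_div_iff₀ two_pos pi_pos]
    nlinarith [pi_le_four]
  simp only [detourEq₁, sin_zero]
  nlinarith

theorem exists_detourEq₁_eq_zero {k x : ℝ} (hk : 5 / 6 ≤ k) (hk1 : k ≤ 1) (hx : 0 < x)
    (hx' : x ≤ π / 2) : ∃ y, 0 < y ∧ y < x / 2 ∧ detourEq₁ k x y = 0 := by
  have h0 := detourEq₁_zero_pos hk hx hx'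
  have h1 : detourEq₁ k x (x / 2) < 0 := by
    have := mul_sin_lt_of_pos hk1 hx (by linarith [pi_pos])
    rw [detourEq₁]
    nlinarith
  have hc : ContinuousOn (detourEq₁ k x) (Icc 0 (x / 2)) := by
    unfold detourEq₁
    fun_prop
  obtain ⟨y, hy, hy'⟩ := intermediate_value_Icc' (by linarith) hc ⟨h1.le, h0.le⟩
  refine ⟨y, lt_of_le_of_ne hy.1 ?_, lt_of_le_of_ne hy.2 ?_, hy'⟩
  · rintro rfl; linarith
  · rintro rfl; linarith

/-- Intermediate value theorem along the solutions of the first equation. -/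
theorem exists_detourEq_eq_zero {κ ξ : ℝ → ℝ} {s t : ℝ} (hst : s ≤ t)
    (hκc : ContinuousOn κ (Icc s t)) (hξc : ContinuousOn ξ (Icc s t))
    (hκ : ∀ r ∈ Icc s t, 5 / 6 ≤ κ r ∧ κ r ≤ 1) (hξ : ∀ r ∈ Icc s t, 0 < ξ r ∧ ξ r ≤ π / 2)
    (hs : ∀ y, 0 < y → y < ξ s / 2 → detourEq₁ (κ s) (ξ s) y = 0 → 0 ≤ detourEq₂ (κ s) (ξ s) y)
    (ht : ∀ y, 0 < y → y < ξ t / 2 → detourEq₁ (κ t) (ξ t) y = 0 → detourEq₂ (κ t) (ξ t) y ≤ 0) :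
    ∃ r ∈ Icc s t, ∃ y, 0 < y ∧ y < ξ r / 2 ∧ detourEq₁ (κ r) (ξ r) y = 0 ∧
      detourEq₂ (κ r) (ξ r) y = 0 := by
  have hex : ∀ r, ∃ y, r ∈ Icc s t → 0 < y ∧ y < ξ r / 2 ∧ detourEq₁ (κ r) (ξ r) y = 0 := by
    intro r
    by_cases hr : r ∈ Icc s t
    · obtain ⟨y, hy⟩ := exists_detourEq₁_eq_zero (hκ r hr).1 (hκ r hr).2 (hξ r hr).1 (hξ r hr).2
      exact ⟨y, fun _ => hy⟩
    · exact ⟨0, fun h => absurd h hr⟩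
  choose Y hY using hex
  have hYc : ContinuousOn Y (Icc s t) := by
    intro r hr
    obtain ⟨h1, h2, h3⟩ := hY r hr
    -- `E₁` falls in `y` with slope at most `-(2k-1) ≤ -2/3`, so `|Y q - Y r|` is at most `3/2`
    -- times the residual of `Y r` at the parameter `q`.
    have hE : Filter.Tendsto (fun q => 3 / 2 * |detourEq₁ (κ q) (ξ q) (Y r)|)
        (nhdsWithin r (Icc s t)) (nhds 0) := by
      have hcE : ContinuousOn (fun q => 3 / 2 * |detourEq₁ (κ q) (ξ q) (Y r)|) (Icc s t) := by
        unfold detourEq₁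
        fun_prop
      have := hcE r hr
      rw [ContinuousWithinAt, h3, abs_zero, mul_zero] at this
      exact this
    rw [ContinuousWithinAt, tendsto_iff_dist_tendsto_zero]
    refine squeeze_zero' (Filter.Eventually.of_forall fun _ => dist_nonneg) ?_ hE
    filter_upwards [self_mem_nhdsWithin] with q hq
    obtain ⟨g1, g2, g3⟩ := hY q hq
    have hkq := (hκ q hq).1
    have hπ := (hξ q hq).2
    have hπ' := (hξ r hr).2
    have key : detourEq₁ (κ q) (ξ q) (Y r) =
        sin (Y q) - sin (Y r) + (2 * κ q - 1) * (Y q - Y r) := by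
      have : detourEq₁ (κ q) (ξ q) (Y r) =
        detourEq₁ (κ q) (ξ q) (Y q) + (sin (Y q) - sin (Y r) + (2 * κ q - 1) * (Y q - Y r)) := by
        simp only [detourEq₁]; ring
      rw [this, g3, zero_add]
    rw [key, Real.dist_eq]
    rcases le_total (Y r) (Y q) with hle | hle
    · have := sin_le_sin_of_le_of_le_pi_div_two (by linarith) (by linarith) hle
      rw [abs_of_nonneg (by linarith), abs_of_nonneg (by nlinarith)]
      nlinarith
    · have := sin_le_sin_of_le_of_le_pi_div_two (by linarith) (by linarith) hle
      rw [abs_of_nonpos (by linarith), abs_of_nonpos (by nlinarith)]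
      nlinarith
  have hFc : ContinuousOn (fun r => detourEq₂ (κ r) (ξ r) (Y r)) (Icc s t) := by
    unfold detourEq₂
    fun_prop
  obtain ⟨s1, s2, s3⟩ := hY s ⟨le_rfl, hst⟩
  obtain ⟨t1, t2, t3⟩ := hY t ⟨hst, le_rfl⟩
  obtain ⟨r, hr, hr0⟩ := intermediate_value_Icc' hst hFc ⟨ht _ t1 t2 t3, hs _ s1 s2 s3⟩
  obtain ⟨r1, r2, r3⟩ := hY r hr
  exact ⟨r, hr, Y r, r1, r2, r3, hr0⟩

/-! ### Certified numerical bounds for sine and cosine. -/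

/-- Taylor polynomial of the sine with `n` terms. -/
noncomputable def sinPoly (n : ℕ) (x : ℝ) : ℝ :=
  ∑ i ∈ Finset.range n, (-1) ^ i * x ^ (2 * i + 1) / (2 * i + 1).factorial

/-- Taylor polynomial of the cosine with `n` terms. -/
noncomputable def cosPoly (n : ℕ) (x : ℝ) : ℝ :=
  ∑ i ∈ Finset.range n, (-1) ^ i * x ^ (2 * i) / (2 * i).factorial

theorem hasDerivAt_sinPoly (n : ℕ) (x : ℝ) : HasDerivAt (sinPoly n) (cosPoly n x) x := by
  unfold sinPoly cosPoly
  refine HasDerivAt.fun_sum fun i _ => ?_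
  have h := (((hasDerivAt_pow (2 * i + 1) x).const_mul ((-1) ^ i)).div_const
    ((2 * i + 1).factorial : ℝ))
  refine h.congr_deriv ?_
  rw [Nat.factorial_succ, Nat.add_sub_cancel]
  have : (((2 * i).factorial : ℕ) : ℝ) ≠ 0 := by positivity
  have : (((2 * i + 1 : ℕ)) : ℝ) ≠ 0 := by positivity
  push_cast at *
  field_simp

theorem hasDerivAt_cosPoly (n : ℕ) (x : ℝ) : HasDerivAt (cosPoly (n + 1)) (-sinPoly n x) x := by
  have e : cosPoly (n + 1) = fun x => (∑ i ∈ Finset.range n,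
      (-1 : ℝ) ^ (i + 1) * x ^ (2 * i + 2) / (2 * i + 2).factorial) + 1 := by
    funext x
    simp [cosPoly, Finset.sum_range_succ', mul_add]
  rw [e]
  refine HasDerivAt.add_const _ ?_
  unfold sinPoly
  rw [← Finset.sum_neg_distrib]
  refine HasDerivAt.fun_sum fun i _ => ?_
  have h := (((hasDerivAt_pow (2 * i + 2) x).const_mul ((-1) ^ (i + 1))).div_const
    ((2 * i + 2).factorial : ℝ))
  refine h.congr_deriv ?_
  rw [Nat.factorial_succ (2 * i + 1), show 2 * i + 2 - 1 = 2 * i + 1 by omega]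
  have : (((2 * i + 1).factorial : ℕ) : ℝ) ≠ 0 := by positivity
  have : (((2 * i + 1 + 1 : ℕ)) : ℝ) ≠ 0 := by positivity
  push_cast at *
  field_simp
  ring

theorem nonneg_of_hasDerivAt {f f' : ℝ → ℝ} (hf : ∀ x, HasDerivAt f (f' x) x)
    (hf' : ∀ x, 0 ≤ x → 0 ≤ f' x) (h0 : f 0 = 0) {x : ℝ} (hx : 0 ≤ x) : 0 ≤ f x := by
  have h : MonotoneOn f (Ici 0) := by
    refine monotoneOn_of_deriv_nonneg (convex_Ici 0)
      (fun t _ => (hf t).continuousAt.continuousWithinAt)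
      (fun t _ => (hf t).differentiableAt.differentiableWithinAt) fun t ht => ?_
    rw [interior_Ici] at ht
    rw [(hf t).deriv]
    exact hf' t (le_of_lt ht)
  rw [← h0]
  exact h (mem_Ici.mpr le_rfl) hx hx

/-- The Taylor polynomials of sine and cosine bound them alternately from above and below. -/
theorem sinPoly_cosPoly_alternate (n : ℕ) :
    (∀ x, 0 ≤ x → 0 ≤ (-1) ^ (n + 1) * (cos x - cosPoly (n + 1) x)) ∧
    ∀ x, 0 ≤ x → 0 ≤ (-1) ^ (n + 1) * (sin x - sinPoly (n + 1) x) := by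
  have hsin : ∀ m, (∀ x, 0 ≤ x → 0 ≤ (-1) ^ m * (cos x - cosPoly m x)) →
      ∀ x, 0 ≤ x → 0 ≤ (-1) ^ m * (sin x - sinPoly m x) := by
    intro m h x hx
    refine nonneg_of_hasDerivAt (f := fun x => (-1) ^ m * (sin x - sinPoly m x))
      (fun x => ((hasDerivAt_sin x).fun_sub (hasDerivAt_sinPoly m x)).const_mul _) h ?_ hx
    simp [sinPoly]
  have hcos : ∀ m, (∀ x, 0 ≤ x → 0 ≤ (-1) ^ m * (sin x - sinPoly m x)) →
      ∀ x, 0 ≤ x → 0 ≤ (-1) ^ (m + 1) * (cos x - cosPoly (m + 1) x) := by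
    intro m h x hx
    refine nonneg_of_hasDerivAt (f := fun x => (-1) ^ (m + 1) * (cos x - cosPoly (m + 1) x))
      (fun x => ((hasDerivAt_cos x).fun_sub (hasDerivAt_cosPoly m x)).const_mul _)
      (fun x hx => ?_) ?_ hx
    · have := h x hx
      rw [pow_succ]
      linarith
    · simp [cosPoly, Finset.sum_range_succ']
  induction n with
  | zero =>
    have h : ∀ x : ℝ, 0 ≤ x → 0 ≤ (-1) ^ (0 + 1) * (cos x - cosPoly (0 + 1) x) := by
      intro x _
      have := cos_le_one x
      simp [cosPoly]
      linarith
    exact ⟨h, hsin _ h⟩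
  | succ n ih =>
    have h := hcos _ ih.2
    exact ⟨h, hsin _ h⟩

theorem sin_le_sinPoly {x : ℝ} (hx : 0 ≤ x) : sin x ≤ sinPoly 7 x := by
  have := (sinPoly_cosPoly_alternate 6).2 x hx
  norm_num at this
  linarith

theorem sinPoly_le_sin {x : ℝ} (hx : 0 ≤ x) : sinPoly 8 x ≤ sin x := by
  have := (sinPoly_cosPoly_alternate 7).2 x hx
  norm_num at this
  linarith

theorem cos_le_cosPoly {x : ℝ} (hx : 0 ≤ x) : cos x ≤ cosPoly 7 x := by
  have := (sinPoly_cosPoly_alternate 6).1 x hx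
  norm_num at this
  linarith

theorem cosPoly_le_cos {x : ℝ} (hx : 0 ≤ x) : cosPoly 8 x ≤ cos x := by
  have := (sinPoly_cosPoly_alternate 7).1 x hx
  norm_num at this
  linarith

theorem le_sin_of_le_sinPoly {x c : ℝ} (hx : 0 ≤ x) (h : c ≤ sinPoly 8 x) : c ≤ sin x :=
  h.trans (sinPoly_le_sin hx)

theorem sin_le_of_sinPoly_le {x c : ℝ} (hx : 0 ≤ x) (h : sinPoly 7 x ≤ c) : sin x ≤ c :=
  (sin_le_sinPoly hx).trans h

theorem le_cos_of_le_cosPoly {x c : ℝ} (hx : 0 ≤ x) (h : c ≤ cosPoly 8 x) : c ≤ cos x :=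
  h.trans (cosPoly_le_cos hx)

theorem cos_le_of_cosPoly_le {x c : ℝ} (hx : 0 ≤ x) (h : cosPoly 7 x ≤ c) : cos x ≤ c :=
  (cos_le_cosPoly hx).trans h

/-- On an interval inside `[0, π]` the sine is at least its smaller value at the end points. -/
theorem le_sin_of_mem_Icc {a b t c : ℝ} (ha : 0 ≤ a) (hb : b ≤ π) (hat : a ≤ t) (htb : t ≤ b)
    (hca : c ≤ sin a) (hcb : c ≤ sin b) : c ≤ sin t := by
  rcases le_total t (π / 2) with h | h
  · exact hca.trans (sin_le_sin_of_le_of_le_pi_div_two (by linarith [pi_pos]) h hat)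
  · rw [← sin_pi_sub t]
    rw [← sin_pi_sub b] at hcb
    exact hcb.trans (sin_le_sin_of_le_of_le_pi_div_two (by linarith) (by linarith) (by linarith))

/-! ### Existence and uniqueness of the root. -/

/-- `(x, y)` solves both equations in the relevant range. -/
structure IsRoot (k x y : ℝ) : Prop where
  x_pos : 0 < x
  x_lt : x < π / 2
  y_pos : 0 < y
  y_lt : y < x / 2
  eq₁ : detourEq₁ k x y = 0
  eq₂ : detourEq₂ k x y = 0

theorem IsRoot.unique {k x y x' y' : ℝ} (hk : 5 / 6 ≤ k) (h : IsRoot k x y)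
    (h' : IsRoot k x' y') : x' = x ∧ y' = y := by
  have key : ∀ {x y x' y'}, IsRoot k x y → IsRoot k x' y' → ¬x < x' := by
    intro x y x' y' h h' hlt
    exact (detourEq₂_neg_of_lt hk h.x_pos hlt h'.x_lt.le h.y_pos h.y_lt h'.y_pos h'.y_lt h.eq₁
      h'.eq₁ h.eq₂.le).ne h'.eq₂
  have hx : x' = x := le_antisymm (not_lt.mp (key h h')) (not_lt.mp (key h' h))
  subst hx
  refine ⟨rfl, ?_⟩
  have h1 := h.x_lt
  have h2 := h.y_lt
  have h3 := h'.y_lt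
  rcases lt_trichotomy y y' with hlt | heq | hlt
  · have := detourEq₁_strictAnti hk h.y_pos.le (by linarith [pi_pos]) hlt (x := x')
    rw [h.eq₁, h'.eq₁] at this
    exact absurd this (lt_irrefl _)
  · exact heq.symm
  · have := detourEq₁_strictAnti hk h'.y_pos.le (by linarith [pi_pos]) hlt (x := x')
    rw [h.eq₁, h'.eq₁] at this
    exact absurd this (lt_irrefl _)

/-- Along `E₁ = 0` with `k` fixed, `E₂` is nonnegative at `x = 1/5` and negative at `x = π/2`. -/
theorem exists_isRoot {k : ℝ} (hk : 5 / 6 ≤ k) (hk1 : k ≤ 1) : ∃ x y, IsRoot k x y := by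
  have hπ := pi_gt_d2
  have hstart : ∀ y, 0 < y → y < 1 / 5 / 2 → detourEq₁ k (1 / 5) y = 0 →
      0 ≤ detourEq₂ k (1 / 5) y := by
    intro y hy hy' h1
    have hs : (0.19866 : ℝ) ≤ sin (1 / 5) := le_sin_of_le_sinPoly (by norm_num)
      (by norm_num [sinPoly, Finset.sum_range_succ, Nat.factorial])
    have hsy : sin y ≤ y := sin_le hy.le
    have hsy' : y - y ^ 3 / 6 < sin y := sin_gt_sub_cube hy
    have hu : sin (1 / 5 - y - sin y) ≤ 1 / 5 - y - sin y := sin_le (by linarith)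
    rw [detourEq₁] at h1
    rw [detourEq₂]
    have h2 : y * y ≤ 1 / 100 := by nlinarith
    have h3 : y ^ 3 ≤ y / 100 := by nlinarith
    have h4 : k * sin (1 / 5 - y - sin y) ≤ k * (1 / 5 - 2 * y + y / 400) :=
      mul_le_mul_of_nonneg_left (by linarith) (by linarith)
    have h5 : k * sin (1 / 5) ≤ (1 - k) * (1 / 5) + 2 * k * y := by nlinarith
    nlinarith
  obtain ⟨r, hr, y, hy, hyr, h1, h2⟩ := exists_detourEq_eq_zero (κ := fun _ => k) (ξ := fun x => x)
    (s := 1 / 5) (t := π / 2) (by linarith) continuousOn_const continuousOn_id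
    (fun _ _ => ⟨hk, hk1⟩) (fun r hr => ⟨by linarith [hr.1], hr.2⟩) hstart
    (fun y hy hy' h1 =>
      (detourEq₂_neg_of_pi_div_two_le hk hk1 le_rfl (by linarith) hy hy' h1).le)
  refine ⟨r, y, by linarith [hr.1], lt_of_le_of_ne hr.2 ?_, hy, hyr, h1, h2⟩
  rintro rfl
  exact (detourEq₂_neg_of_pi_div_two_le hk hk1 le_rfl (by linarith) hy hyr h1).ne h2

theorem one_div_add_one_bounds {w : ℝ} (hw : 0 ≤ w) (hw' : w ≤ 1 / 5) :
    5 / 6 ≤ 1 / (w + 1) ∧ 1 / (w + 1) ≤ 1 := by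
  constructor
  · rw [div_le_div_iff₀ (by norm_num) (by linarith)]
    linarith
  · rw [div_le_one (by linarith)]
    linarith

/-- For `w ∈ [0, 1/5]` the nonlinear system has exactly one solution. -/
theorem existsUnique_isDetourSolution {w : ℝ} (hw : 0 ≤ w) (hw' : w ≤ 1 / 5) :
    ∃ x y, IsRoot (1 / (w + 1)) x y ∧
      ∀ α β, IsDetourSolution w α β ↔ α = π - x ∧ β = 2 * y := by
  obtain ⟨hk, hk1⟩ := one_div_add_one_bounds hw hw'
  obtain ⟨x, y, h⟩ := exists_isRoot hk hk1
  refine ⟨x, y, h, fun α β => ?_⟩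
  constructor
  · intro hs
    obtain ⟨x', rfl⟩ : ∃ x', α = π - x' := ⟨π - α, by ring⟩
    obtain ⟨y', rfl⟩ : ∃ y', β = 2 * y' := ⟨β / 2, by ring⟩
    obtain ⟨a1, a2, a3, a4, a5⟩ := (isDetourSolution_iff hw x' y').mp hs
    obtain ⟨b1, b2, b3⟩ := apriori_bounds hk hk1 a1 a2 a3 a4 a5
    obtain ⟨rfl, rfl⟩ := h.unique hk ⟨b1, b2, a2, b3, a4, a5⟩
    exact ⟨rfl, rfl⟩
  · rintro ⟨rfl, rfl⟩
    refine (isDetourSolution_iff hw x y).mpr ⟨?_, h.y_pos, ?_, h.eq₁, h.eq₂⟩ <;>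
      linarith [h.x_lt, h.y_lt, h.x_pos, pi_pos]

/-! ### The threshold `w₀`. -/

/-- First equation for `k = 1 / (2 cos x)`, times `2 cos x`. -/
noncomputable def thresholdEq₁ (x y : ℝ) : ℝ :=
  sin x - (2 * cos x - 1) * x - 2 * cos x * sin y - 2 * (1 - cos x) * y

/-- Second equation for `k = 1 / (2 cos x)`, times `2 cos x`. -/
noncomputable def thresholdEq₂ (x y : ℝ) : ℝ :=
  sin x - 2 * cos x * (x - y) - sin (x - y - sin y)

theorem thresholdEq₁_eq {w x y : ℝ} (hw : 0 ≤ w) (h : 2 * cos x = w + 1) :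
    thresholdEq₁ x y = (w + 1) * detourEq₁ (1 / (w + 1)) x y := by
  have : w + 1 ≠ 0 := by linarith
  rw [thresholdEq₁, detourEq₁, show cos x = (w + 1) / 2 by linarith]
  field_simp

theorem thresholdEq₂_eq {w x y : ℝ} (hw : 0 ≤ w) (h : 2 * cos x = w + 1) :
    thresholdEq₂ x y = (w + 1) * detourEq₂ (1 / (w + 1)) x y := by
  have : w + 1 ≠ 0 := by linarith
  rw [thresholdEq₂, detourEq₂, show cos x = (w + 1) / 2 by linarith]
  field_simp
  ring

/-- The interval contains `arccos((w+1)/2)` for all `w ∈ [0, 1/5]`. -/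
theorem trig_bounds_of_mem {x : ℝ} (h1 : 37 / 40 ≤ x) (h2 : x ≤ π / 3) :
    1 / 2 ≤ cos x ∧ cos x ≤ 0.6019 ∧ 0.798 ≤ sin x := by
  have hπ := pi_lt_d2
  refine ⟨?_, ?_, ?_⟩
  · rw [← cos_pi_div_three]
    exact cos_le_cos_of_nonneg_of_le_pi (by linarith) (by linarith) h2
  · refine (cos_le_cos_of_nonneg_of_le_pi (by norm_num) (by linarith) h1).trans ?_
    exact cos_le_of_cosPoly_le (by norm_num)
      (by norm_num [cosPoly, Finset.sum_range_succ, Nat.factorial])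
  · refine le_trans ?_ (sin_le_sin_of_le_of_le_pi_div_two (by linarith) (by linarith) h1)
    exact le_sin_of_le_sinPoly (by norm_num)
      (by norm_num [sinPoly, Finset.sum_range_succ, Nat.factorial])

theorem monotoneOn_of_hasDerivAt {f f' : ℝ → ℝ} {a b : ℝ} (hf : ∀ x, HasDerivAt f (f' x) x)
    (hf' : ∀ x, a ≤ x → x ≤ b → 0 ≤ f' x) : MonotoneOn f (Icc a b) := by
  refine monotoneOn_of_deriv_nonneg (convex_Icc a b)
    (fun t _ => (hf t).continuousAt.continuousWithinAt)
    (fun t _ => (hf t).differentiableAt.differentiableWithinAt) fun t ht => ?_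
  rw [interior_Icc] at ht
  rw [(hf t).deriv]
  exact hf' t ht.1.le ht.2.le

theorem thresholdEq₁_growth {x₁ x₂ y : ℝ} (h1 : 37 / 40 ≤ x₁) (h12 : x₁ ≤ x₂) (h2 : x₂ ≤ π / 3)
    (hy : 0 ≤ y) (hy' : y ≤ x₁ / 2) :
    (x₂ - x₁) / 4 ≤ thresholdEq₁ x₂ y - thresholdEq₁ x₁ y := by
  have hd : ∀ x, HasDerivAt (fun x => thresholdEq₁ x y - x / 4)
      (cos x - (2 * -sin x * x + (2 * cos x - 1) * 1) - 2 * -sin x * sin y - 2 * (0 - -sin x) * y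
        - 1 / 4) x := by
    intro x
    have d1 := ((hasDerivAt_cos x).const_mul 2)
    have d2 := (d1.sub_const 1).fun_mul (hasDerivAt_id x)
    have d3 := d1.mul_const (sin y)
    have d4 := ((((hasDerivAt_const x (1 : ℝ)).fun_sub (hasDerivAt_cos x)).const_mul 2)).mul_const y
    exact ((((hasDerivAt_sin x).fun_sub d2).fun_sub d3).fun_sub d4).fun_sub
      ((hasDerivAt_id x).div_const 4)
  have hmono := monotoneOn_of_hasDerivAt (a := x₁) (b := x₂) hd fun x hx1 hx2 => by
    obtain ⟨c1, c2, c3⟩ := trig_bounds_of_mem (h1.trans hx1) (hx2.trans h2)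
    have hsy : 0 ≤ sin y := sin_nonneg_of_nonneg_of_le_pi hy (by linarith [pi_pos])
    have : 0.798 * 0.46 ≤ sin x * (x - y + sin y) :=
      mul_le_mul c3 (by linarith) (by norm_num) (by linarith)
    nlinarith
  have := hmono ⟨le_rfl, h12⟩ ⟨h12, le_rfl⟩ h12
  simp only at this
  linarith

/-- The `x`-derivative is `1 - 2 cos x - cos u + 2 sin x (2x - 2y + sin y)` with `u = x - y - sin
y`. The crude bounds leave about `0.27`; this dictates the constant `1/4`. -/
theorem thresholdSum_growth {x₁ x₂ y : ℝ} (h1 : 37 / 40 ≤ x₁) (h12 : x₁ ≤ x₂) (h2 : x₂ ≤ π / 3)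
    (hy : 0 ≤ y) (hy' : y ≤ x₁ / 2) :
    (x₂ - x₁) / 4 ≤ thresholdEq₁ x₂ y + thresholdEq₂ x₂ y -
      (thresholdEq₁ x₁ y + thresholdEq₂ x₁ y) := by
  have hd : ∀ x, HasDerivAt (fun x => thresholdEq₁ x y + thresholdEq₂ x y - x / 4)
      (cos x - (2 * -sin x * x + (2 * cos x - 1) * 1) - 2 * -sin x * sin y - 2 * (0 - -sin x) * y
        + (cos x - (2 * -sin x * (x - y) + 2 * cos x * 1) - cos (x - y - sin y) * 1) - 1 / 4) x := by
    intro x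
    have d1 := ((hasDerivAt_cos x).const_mul 2)
    have d2 := (d1.sub_const 1).fun_mul (hasDerivAt_id x)
    have d3 := d1.mul_const (sin y)
    have d4 := ((((hasDerivAt_const x (1 : ℝ)).fun_sub (hasDerivAt_cos x)).const_mul 2)).mul_const y
    have d5 := d1.fun_mul ((hasDerivAt_id x).sub_const y)
    have d6 := (((hasDerivAt_id x).sub_const y).sub_const (sin y)).sin
    exact (((((hasDerivAt_sin x).fun_sub d2).fun_sub d3).fun_sub d4).fun_add
      (((hasDerivAt_sin x).fun_sub d5).fun_sub d6)).fun_sub ((hasDerivAt_id x).div_const 4)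
  have hmono := monotoneOn_of_hasDerivAt (a := x₁) (b := x₂) hd fun x hx1 hx2 => by
    obtain ⟨c1, c2, c3⟩ := trig_bounds_of_mem (h1.trans hx1) (hx2.trans h2)
    have hsy : 0 ≤ sin y := sin_nonneg_of_nonneg_of_le_pi hy (by linarith [pi_pos])
    have := cos_le_one (x - y - sin y)
    have : 0.798 * 0.925 ≤ sin x * (2 * x - 2 * y + sin y) :=
      mul_le_mul c3 (by linarith) (by norm_num) (by linarith)
    nlinarith
  have := hmono ⟨le_rfl, h12⟩ ⟨h12, le_rfl⟩ h12
  simp only at this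
  linarith

theorem thresholdEq₁_anti {x y y' : ℝ} (h1 : 37 / 40 ≤ x) (h2 : x ≤ π / 3) (hy : 0 ≤ y)
    (hyy : y ≤ y') (hy' : y' ≤ x / 2) : thresholdEq₁ x y' ≤ thresholdEq₁ x y := by
  obtain ⟨c1, c2, c3⟩ := trig_bounds_of_mem h1 h2
  have := sin_le_sin_of_le_of_le_pi_div_two (by linarith [pi_pos]) (by linarith [pi_pos]) hyy
  simp only [thresholdEq₁]
  nlinarith

/-- The `y`-derivative is at least `(1 - cos y)/2`, from `cos x ≥ 1/2` and `cos(x - y - sin y) ≥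
1/2`. -/
theorem thresholdSum_mono {x y y' : ℝ} (h1 : 37 / 40 ≤ x) (h2 : x ≤ π / 3) (hy : 0 ≤ y)
    (hyy : y ≤ y') (hy' : y' ≤ x / 2) :
    thresholdEq₁ x y + thresholdEq₂ x y ≤ thresholdEq₁ x y' + thresholdEq₂ x y' := by
  obtain ⟨c1, c2, c3⟩ := trig_bounds_of_mem h1 h2
  have hd : ∀ y, HasDerivAt (fun y => thresholdEq₁ x y + thresholdEq₂ x y)
      ((0 - 2 * cos x * cos y - 2 * (1 - cos x) * 1) +
        (0 - 2 * cos x * (0 - 1) - cos (x - y - sin y) * (0 - 1 - cos y))) y := by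
    intro y
    have d1 := (hasDerivAt_const y (sin x - (2 * cos x - 1) * x)).fun_sub
      ((hasDerivAt_sin y).const_mul (2 * cos x))
    have d2 := d1.fun_sub ((hasDerivAt_id y).const_mul (2 * (1 - cos x)))
    have d3 := (hasDerivAt_const y (sin x)).fun_sub
      (((hasDerivAt_const y x).fun_sub (hasDerivAt_id y)).const_mul (2 * cos x))
    have d4 := (((hasDerivAt_const y x).fun_sub (hasDerivAt_id y)).fun_sub (hasDerivAt_sin y)).sin
    exact d2.fun_add (d3.fun_sub d4)
  have hmono := monotoneOn_of_hasDerivAt (a := y) (b := y') hd fun z hz1 hz2 => by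
    have hz : 0 ≤ z := hy.trans hz1
    have hsz : sin z ≤ z := sin_le hz
    have hsz0 : 0 ≤ sin z := sin_nonneg_of_nonneg_of_le_pi hz (by linarith [pi_pos])
    have hcz := cos_le_one z
    have hcz0 : 0 ≤ cos z :=
      cos_nonneg_of_neg_pi_div_two_le_of_le (by linarith [pi_pos]) (by linarith [pi_pos])
    have hu : 1 / 2 ≤ cos (x - z - sin z) := by
      rw [← cos_pi_div_three]
      exact cos_le_cos_of_nonneg_of_le_pi (by linarith) (by linarith [pi_pos]) (by linarith)
    nlinarith
  exact hmono ⟨le_rfl, hyy⟩ ⟨hyy, le_rfl⟩ hyy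

/-- The two threshold equations are transversal. -/
theorem threshold_transversal {x₁ y₁ x₂ y₂ : ℝ} (h1 : 37 / 40 ≤ x₁) (h12 : x₁ ≤ x₂)
    (h2 : x₂ ≤ π / 3) (hy₁ : 0 ≤ y₁) (hy₁' : y₁ ≤ x₁ / 2) (hy₂ : 0 ≤ y₂) (hy₂' : y₂ ≤ x₂ / 2) :
    (x₂ - x₁) / 4 ≤ thresholdEq₁ x₂ y₂ - thresholdEq₁ x₁ y₁ ∨
    (x₂ - x₁) / 4 ≤ thresholdEq₁ x₂ y₂ + thresholdEq₂ x₂ y₂ -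
      (thresholdEq₁ x₁ y₁ + thresholdEq₂ x₁ y₁) := by
  -- The first function decreases in `y` and the sum increases in `y`; whichever way `y` moves, one
  -- of the two keeps its growth in `x`.
  rcases le_total y₂ y₁ with h | h
  · left
    have a1 := thresholdEq₁_growth h1 h12 h2 hy₁ hy₁'
    have a2 := thresholdEq₁_anti (h1.trans h12) h2 hy₂ h (by linarith)
    linarith
  · right
    have a1 := thresholdSum_growth h1 h12 h2 hy₁ hy₁'
    have a2 := thresholdSum_mono (h1.trans h12) h2 hy₁ h hy₂'
    linarith

theorem threshold_numeric_root :
    |thresholdEq₁ 1.02061058005 0.40880103312| ≤ 1 / 10 ^ 9 ∧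
    |thresholdEq₂ 1.02061058005 0.40880103312| ≤ 1 / 10 ^ 9 ∧
    |2 * cos 1.02061058005 - 1 - 0.0456911471| ≤ 1 / 10 ^ 9 := by
  have s1 : 0.85242741990 ≤ sin 1.02061058005 := le_sin_of_le_sinPoly (by norm_num)
    (by norm_num [sinPoly, Finset.sum_range_succ, Nat.factorial])
  have s2 : sin 1.02061058005 ≤ 0.85242742010 := sin_le_of_sinPoly_le (by norm_num)
    (by norm_num [sinPoly, Finset.sum_range_succ, Nat.factorial])
  have c1 : 0.52284557350 ≤ cos 1.02061058005 := le_cos_of_le_cosPoly (by norm_num)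
    (by norm_num [cosPoly, Finset.sum_range_succ, Nat.factorial])
  have c2 : cos 1.02061058005 ≤ 0.52284557365 := cos_le_of_cosPoly_le (by norm_num)
    (by norm_num [cosPoly, Finset.sum_range_succ, Nat.factorial])
  have t1 : 0.39750944424 ≤ sin 0.40880103312 := le_sin_of_le_sinPoly (by norm_num)
    (by norm_num [sinPoly, Finset.sum_range_succ, Nat.factorial])
  have t2 : sin 0.40880103312 ≤ 0.39750944427 := sin_le_of_sinPoly_le (by norm_num)
    (by norm_num [sinPoly, Finset.sum_range_succ, Nat.factorial])
  have hπ := pi_gt_three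
  have u1 : 0.21266359290 ≤ sin (1.02061058005 - 0.40880103312 - sin 0.40880103312) := by
    refine le_trans ?_ (sin_le_sin_of_le_of_le_pi_div_two (x := 0.21430010266) (by linarith)
      (by linarith) (by linarith))
    exact le_sin_of_le_sinPoly (by norm_num)
      (by norm_num [sinPoly, Finset.sum_range_succ, Nat.factorial])
  have u2 : sin (1.02061058005 - 0.40880103312 - sin 0.40880103312) ≤ 0.21266359300 := by
    refine (sin_le_sin_of_le_of_le_pi_div_two (y := 0.21430010269) (by linarith)
      (by linarith) (by linarith)).trans ?_
    exact sin_le_of_sinPoly_le (by norm_num)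
      (by norm_num [sinPoly, Finset.sum_range_succ, Nat.factorial])
  refine ⟨?_, ?_, ?_⟩
  · rw [thresholdEq₁, abs_le]
    constructor <;> nlinarith
  · rw [thresholdEq₂, abs_le]
    constructor <;> linarith
  · rw [abs_le]
    constructor <;> linarith

/-- The start `w = 0` of the threshold path. The first equation reads `y + sin y = √3/2`, which
makes the inner argument explicit and gives `y ≥ √3/4`. -/
theorem detourEq₂_nonneg_at_zero {y : ℝ} (hy : 0 < y) (h₁ : detourEq₁ 1 (π / 3) y = 0) :
    0 ≤ detourEq₂ 1 (π / 3) y := by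
  rw [detourEq₁, sin_pi_div_three] at h₁
  rw [detourEq₂, sin_pi_div_three, show π / 3 - y - sin y = π / 3 - √3 / 2 by linarith]
  have h3 : (1.73 : ℝ) ≤ √3 := Real.le_sqrt_of_sq_le (by norm_num)
  have hπ := pi_lt_d2
  have hπ' := pi_gt_d2
  have h4 : √3 ≤ 1.74 := by
    rw [Real.sqrt_le_left (by norm_num)]
    norm_num
  have := sin_le (x := π / 3 - √3 / 2) (by linarith)
  have := sin_le hy.le
  linarith

/-- The end `w = 1/5` of the threshold path, where `cos x = 3/5` and `sin x = 4/5` exactly. -/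
theorem detourEq₂_nonpos_at_fifth {y : ℝ} (hy : 0 < y) (hy' : y < arccos (3 / 5) / 2)
    (h₁ : detourEq₁ (5 / 6) (arccos (3 / 5)) y = 0) :
    detourEq₂ (5 / 6) (arccos (3 / 5)) y ≤ 0 := by
  have hs : sin (arccos (3 / 5)) = 4 / 5 := by
    rw [sin_arccos, show (1 : ℝ) - (3 / 5) ^ 2 = (4 / 5) ^ 2 by norm_num,
      Real.sqrt_sq (by norm_num)]
  have hπ := pi_gt_three
  have hl : 0.927 ≤ arccos (3 / 5) := by
    rw [← arccos_cos (x := 0.927) (by norm_num) (by linarith)]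
    exact arccos_le_arccos (le_cos_of_le_cosPoly (by norm_num)
      (by norm_num [cosPoly, Finset.sum_range_succ, Nat.factorial]))
  have hu : arccos (3 / 5) ≤ 0.928 := by
    rw [← arccos_cos (x := 0.928) (by norm_num) (by linarith)]
    exact arccos_le_arccos (cos_le_of_cosPoly_le (by norm_num)
      (by norm_num [cosPoly, Finset.sum_range_succ, Nat.factorial]))
  set X := arccos (3 / 5)
  rw [detourEq₁, hs] at h₁
  rw [detourEq₂, hs]
  have hsy : y - y ^ 3 / 6 < sin y := sin_gt_sub_cube hy
  have hyy : y * y ≤ 0.216 := by nlinarith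
  have hy3 : y ^ 3 ≤ 0.216 * y := by nlinarith
  have hy1 : y ≤ 0.315 := by linarith
  have hsu : 0.28 ≤ sin (X - y - sin y) := by
    refine le_trans ?_ (sin_le_sin_of_le_of_le_pi_div_two (x := 0.29) (by linarith)
      (by linarith [sin_gt_sub_cube hy]) (by linarith [sin_le hy.le]))
    exact le_sin_of_le_sinPoly (by norm_num)
      (by norm_num [sinPoly, Finset.sum_range_succ, Nat.factorial])
  linarith

theorem arccos_threshold_bounds {w : ℝ} (hw : 0 ≤ w) (hw' : w ≤ 1 / 5) :
    2 * cos (arccos ((w + 1) / 2)) = w + 1 ∧ 37 / 40 ≤ arccos ((w + 1) / 2) ∧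
      arccos ((w + 1) / 2) ≤ π / 3 := by
  have hπ := pi_gt_three
  refine ⟨?_, ?_, ?_⟩
  · rw [cos_arccos (by linarith) (by linarith)]
    ring
  · rw [← arccos_cos (x := 37 / 40) (by norm_num) (by linarith)]
    refine arccos_le_arccos (le_trans (by linarith : (w + 1) / 2 ≤ 0.6) ?_)
    exact le_cos_of_le_cosPoly (by norm_num)
      (by norm_num [cosPoly, Finset.sum_range_succ, Nat.factorial])
  · rw [← arccos_cos (x := π / 3) (by linarith) (by linarith)]
    refine arccos_le_arccos ?_
    rw [cos_pi_div_three]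
    linarith

/-- The threshold `w₀`. -/
theorem exists_threshold : ∃ w₀, 0 ≤ w₀ ∧ w₀ ≤ 1 / 5 ∧ |w₀ - 0.0456911| < 1 / 10 ^ 7 ∧
    (∀ w x y, 0 ≤ w → w ≤ 1 / 5 → IsRoot (1 / (w + 1)) x y →
      (x = arccos ((w + 1) / 2) ↔ w = w₀)) ∧
    ∀ w x y, 0 ≤ w → w ≤ w₀ → IsRoot (1 / (w + 1)) x y → arccos ((w + 1) / 2) ≤ x := by
  have hπ := pi_gt_three
  obtain ⟨w₀, ⟨hw₀, hw₀'⟩, y₀, hy₀, hy₀', e₁, e₂⟩ := exists_detourEq_eq_zero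
    (κ := fun w => 1 / (w + 1)) (ξ := fun w => arccos ((w + 1) / 2)) (s := 0) (t := 1 / 5)
    (by norm_num)
    (continuousOn_const.div (by fun_prop) fun w hw => by linarith [hw.1])
    (continuous_arccos.comp (by fun_prop)).continuousOn
    (fun w hw => one_div_add_one_bounds hw.1 hw.2)
    (fun w hw => by
      obtain ⟨-, h1, h2⟩ := arccos_threshold_bounds hw.1 hw.2
      exact ⟨by linarith, by linarith⟩)
    (fun y hy _ h => by
      have e : arccos ((0 + 1) / 2) = π / 3 := by
        rw [← arccos_cos (x := π / 3) (by linarith) (by linarith), cos_pi_div_three, zero_add]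
      simp only [e, show (1 : ℝ) / (0 + 1) = 1 by norm_num] at h ⊢
      exact detourEq₂_nonneg_at_zero hy h)
    (fun y hy hy' h => by
      simp only [show ((1 : ℝ) / 5 + 1) / 2 = 3 / 5 by norm_num,
        show (1 : ℝ) / (1 / 5 + 1) = 5 / 6 by norm_num] at h hy' ⊢
      exact detourEq₂_nonpos_at_fifth hy hy' h)
  obtain ⟨c0, b0, b0'⟩ := arccos_threshold_bounds hw₀ hw₀'
  set x₀ := arccos ((w₀ + 1) / 2)
  have hroot : IsRoot (1 / (w₀ + 1)) x₀ y₀ :=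
    ⟨by linarith, by linarith, hy₀, hy₀', e₁, e₂⟩
  have t₁ : thresholdEq₁ x₀ y₀ = 0 := by rw [thresholdEq₁_eq hw₀ c0, e₁, mul_zero]
  have t₂ : thresholdEq₂ x₀ y₀ = 0 := by rw [thresholdEq₂_eq hw₀ c0, e₂, mul_zero]
  refine ⟨w₀, hw₀, hw₀', ?_, ?_, ?_⟩
  · obtain ⟨n1, n2, n3⟩ := threshold_numeric_root
    -- A residual of at most `2·10⁻⁹` against the growth rate `1/4` gives an error of at most
    -- `8·10⁻⁹`.
    have hx : |x₀ - 1.02061058005| ≤ 1 / 10 ^ 8 := by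
      have hπ' := pi_gt_d2
      rw [abs_le] at n1 n2 ⊢
      rcases le_total x₀ 1.02061058005 with h | h
      · rcases threshold_transversal b0 h (by linarith) hy₀.le hy₀'.le
          (y₂ := 0.40880103312) (by norm_num) (by norm_num) with h' | h' <;>
        constructor <;> linarith
      · rcases threshold_transversal (x₁ := 1.02061058005) (y₁ := 0.40880103312) (by norm_num) h b0'
          (by norm_num) (by norm_num) hy₀.le hy₀'.le with h' | h' <;>
        constructor <;> linarith
    -- Since `w₀ = 2 cos x₀ - 1`, the error is at most `2.1·10⁻⁸`, plus `4.71·10⁻⁸` from rounding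
    -- `0.0456911471`.
    have hc := abs_cos_sub_cos_le x₀ 1.02061058005
    rw [abs_lt]
    rw [abs_le] at hx n3
    have hc' := abs_le.mp (hc.trans (abs_le.mpr hx))
    constructor <;> linarith
  · intro w x y hw hw' h
    obtain ⟨c, b, b'⟩ := arccos_threshold_bounds hw hw'
    constructor
    · rintro rfl
      set x := arccos ((w + 1) / 2)
      have s₁ : thresholdEq₁ x y = 0 := by rw [thresholdEq₁_eq hw c, h.eq₁, mul_zero]
      have s₂ : thresholdEq₂ x y = 0 := by rw [thresholdEq₂_eq hw c, h.eq₂, mul_zero]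
      have hxx : x = x₀ := by
        rcases le_total x x₀ with hle | hle
        · rcases threshold_transversal b hle b0' h.y_pos.le h.y_lt.le hy₀.le hy₀'.le with h' | h' <;>
          linarith
        · rcases threshold_transversal b0 hle b' hy₀.le hy₀'.le h.y_pos.le h.y_lt.le with h' | h' <;>
          linarith
      rw [hxx] at c
      linarith
    · rintro rfl
      exact (hroot.unique (one_div_add_one_bounds hw hw').1 h).1
  · intro w x y hw hww h
    have hw' := hww.trans hw₀'
    rcases eq_or_lt_of_le hww with rfl | hlt
    · exact (hroot.unique (one_div_add_one_bounds hw hw').1 h).1.ge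
    obtain ⟨c, b, b'⟩ := arccos_threshold_bounds hw hw'
    obtain ⟨hk, hk1⟩ := one_div_add_one_bounds hw hw'
    set z := arccos ((w + 1) / 2)
    have hz : x₀ < z := by
      by_contra hge
      have := cos_le_cos_of_nonneg_of_le_pi (by linarith) (by linarith) (not_lt.mp hge)
      linarith
    obtain ⟨y', h1, h2, h3⟩ := exists_detourEq₁_eq_zero hk hk1 (by linarith : 0 < z) (by linarith)
    -- If the root lay left of `z`, then `E₂ < 0` on the curve at `z > x₀`; transversality from
    -- `(x₀, y₀)`, where both functions vanish, forbids this.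
    by_contra hxz
    have hneg := detourEq₂_neg_of_lt hk h.x_pos (not_le.mp hxz) (by linarith) h.y_pos h.y_lt h1 h2
      h.eq₁ h3 h.eq₂.le
    have s₁ : thresholdEq₁ z y' = 0 := by rw [thresholdEq₁_eq hw c, h3, mul_zero]
    have s₂ : thresholdEq₂ z y' < 0 := by
      rw [thresholdEq₂_eq hw c]
      exact mul_neg_of_pos_of_neg (by linarith) hneg
    rcases threshold_transversal b0 hz.le b' hy₀.le hy₀'.le h1.le h2.le with h' | h' <;> linarith

/-! ### Cost on the simultaneous arcs and on the chord. -/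

theorem sin_le_tangent {s d : ℝ} (hs : 0 ≤ s) (hs' : s ≤ π) (hd : 0 ≤ d) (hd' : d ≤ π) :
    sin s ≤ sin d + (s - d) * cos d := by
  have hder : ∀ t, HasDerivAt (fun t => t * cos d - sin t) (1 * cos d - cos t) t := fun t =>
    ((hasDerivAt_id t).mul_const (cos d)).fun_sub (hasDerivAt_sin t)
  rcases le_total d s with h | h
  · have := monotoneOn_of_hasDerivAt (a := d) (b := s) hder (fun t h1 h2 => by
      have := cos_le_cos_of_nonneg_of_le_pi hd (h2.trans hs') h1
      linarith) ⟨le_rfl, h⟩ ⟨h, le_rfl⟩ h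
    simp only at this
    linarith
  · have := monotoneOn_of_hasDerivAt (a := s) (b := d) (fun t => (hder t).fun_neg) (fun t h1 h2 => by
      have := cos_le_cos_of_nonneg_of_le_pi (hs.trans h1) hd' h2
      linarith) ⟨le_rfl, h⟩ ⟨h, le_rfl⟩ h
    simp only at this
    linarith

/-- The cost on the arcs that the agents explore simultaneously is largest at the parameter `d`. -/
theorem add_sin_le {w s d : ℝ} (hw : 0 ≤ w) (hs : 0 ≤ s) (hs' : s ≤ π) (hd : 0 ≤ d) (hd' : d ≤ π)
    (h : (s - d) * ((w + 1) + 2 * cos d) ≤ 0) :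
    1 + s + 2 * sin s / (w + 1) ≤ 1 + d + 2 * sin d / (w + 1) := by
  have hw0 : 0 < w + 1 := by linarith
  have := sin_le_tangent hs hs' hd hd'
  have e : ∀ a b, (1 + a + b / (w + 1)) * (w + 1) = (1 + a) * (w + 1) + b := fun a b => by
    rw [add_mul, div_mul_cancel₀ _ hw0.ne']
  rw [← mul_le_mul_iff_left₀ hw0, e, e]
  linarith

/-- The law of cosines at `c(0)`: the sides are `2h` and `2 sin v`, and the angle between the two
chords is `v - y`. -/
theorem dist_walk_chord {y v h : ℝ} (hy : 0 < sin y) (hh : h ≤ sin y)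
    (hL : dist (circlePt 0) (circlePt (2 * y)) = 2 * sin y) :
    dist (walk (circlePt 0) (circlePt (2 * y)) (2 * h)) (circlePt (2 * v)) ^ 2 =
      4 * (sin v ^ 2 + h ^ 2 - 2 * h * sin v * cos (v - y)) := by
  rw [walk_of_le (by rw [hL]; linarith), hL, EuclideanSpace.dist_eq, Real.sq_sqrt (by positivity),
    Fin.sum_univ_two, Real.dist_eq, Real.dist_eq, sq_abs, sq_abs]
  simp only [circlePt, PiLp.add_apply, PiLp.smul_apply, PiLp.sub_apply, Matrix.cons_val_zero,
    Matrix.cons_val_one, smul_eq_mul, cos_zero, sin_zero]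
  have e1 : 1 + 2 * h / (2 * sin y) * (cos (2 * y) - 1) = 1 - 2 * h * sin y := by
    rw [cos_two_mul, cos_sq']
    field_simp
    ring
  have e2 : 0 + 2 * h / (2 * sin y) * (sin (2 * y) - 0) = 2 * h * cos y := by
    rw [sin_two_mul]
    field_simp
    ring
  rw [e1, e2, cos_two_mul, cos_sq', sin_two_mul, cos_sub]
  linear_combination 4 * h ^ 2 * sin_sq_add_cos_sq y + 4 * sin v ^ 2 * sin_sq_add_cos_sq v

/-- One window `[h₀, h₁]` of a case split: each sine is at least its smaller value at the ends of
the range of its argument. For example `1.573 = 2·1.02 - 0.467` and `1.919 = 2·1.15 - 0.381`. -/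
theorem chord_aux {x y h c₁ c₂ c₃ : ℝ} (h₀ h₁ : ℝ) (hx : 1.02 ≤ x) (hx' : x ≤ 1.15)
    (hy : 0.381 ≤ y) (hy' : y ≤ 0.467) (hh : h₀ ≤ h) (hh' : h ≤ h₁) (h0 : 0 ≤ h₀)
    (h1 : h₁ ≤ 0.46) (hc₁ : 0 ≤ c₁)
    (s₁ : c₁ ≤ sinPoly 8 (2.3 - h₀)) (s₁' : c₁ ≤ sinPoly 8 (2.04 - h₁))
    (s₂ : c₂ ≤ sinPoly 8 (1.919 - 2 * h₀)) (s₂' : c₂ ≤ sinPoly 8 (1.573 - 2 * h₁))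
    (s₃ : c₃ ≤ sin y) (hsum : 1.91 ≤ c₁ * (1 - h₁ ^ 2 / 6) + c₂ + c₃) :
    1.91 ≤ sin (2 * x - h) * (1 - h ^ 2 / 6) + sin (2 * x - 2 * h - y) + sin y := by
  have hπ := pi_gt_three
  have a1 : c₁ ≤ sin (2 * x - h) := le_sin_of_mem_Icc (a := 2.04 - h₁) (b := 2.3 - h₀)
    (by linarith) (by linarith) (by linarith) (by linarith)
    (le_sin_of_le_sinPoly (by linarith) s₁') (le_sin_of_le_sinPoly (by linarith) s₁)
  have a2 : c₂ ≤ sin (2 * x - 2 * h - y) :=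
    le_sin_of_mem_Icc (a := 1.573 - 2 * h₁) (b := 1.919 - 2 * h₀)
      (by linarith) (by linarith) (by linarith) (by linarith)
      (le_sin_of_le_sinPoly (by linarith) s₂') (le_sin_of_le_sinPoly (by linarith) s₂)
  have a3 : c₁ * (1 - h₁ ^ 2 / 6) ≤ sin (2 * x - h) * (1 - h ^ 2 / 6) := by
    have : h ^ 2 ≤ h₁ ^ 2 := by nlinarith
    have : h₁ ^ 2 ≤ 1 := by nlinarith
    exact mul_le_mul a1 (by linarith) (by linarith) (hc₁.trans a1)
  linarith

theorem chord_trig_bound {x y h : ℝ} (hx : 1.02 ≤ x) (hx' : x ≤ 1.15) (hy : 0.381 ≤ y)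
    (hy' : y ≤ 0.467) (hh : 0 ≤ h) (hhy : h ≤ sin y) :
    1.91 ≤ sin (2 * x - h) * (1 - h ^ 2 / 6) + sin (2 * x - 2 * h - y) + sin y := by
  have hπ := pi_gt_three
  have hs : 0.371 ≤ sin y := by
    refine le_trans ?_ (sin_le_sin_of_le_of_le_pi_div_two (by linarith) (by linarith) hy)
    exact le_sin_of_le_sinPoly (by norm_num)
      (by norm_num [sinPoly, Finset.sum_range_succ, Nat.factorial])
  have hs' : sin y ≤ 0.451 := by
    refine (sin_le_sin_of_le_of_le_pi_div_two (by linarith) (by linarith) hy').trans ?_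
    exact sin_le_of_sinPoly_le (by norm_num)
      (by norm_num [sinPoly, Finset.sum_range_succ, Nat.factorial])
  rcases le_total h 0.2 with h1 | h1
  · apply chord_aux (c₁ := 0.745) (c₂ := 0.92) (c₃ := 0.371) 0 0.2 hx hx' hy hy' hh h1 <;>
      norm_num [sinPoly, Finset.sum_range_succ, Nat.factorial]
    linarith
  rcases le_total h 0.33 with h2 | h2
  · apply chord_aux (c₁ := 0.863) (c₂ := 0.79) (c₃ := 0.371) 0.2 0.33 hx hx' hy hy' h1 h2 <;>
      norm_num [sinPoly, Finset.sum_range_succ, Nat.factorial]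
    linarith
  rcases le_total h 0.4 with h3 | h3
  · apply chord_aux (c₁ := 0.92) (c₂ := 0.69) (c₃ := 0.371) 0.33 0.4 hx hx' hy hy' h2 h3 <;>
      norm_num [sinPoly, Finset.sum_range_succ, Nat.factorial]
    linarith
  -- In the last window `sin y ≥ h ≥ 0.4` replaces the general bound `0.371`.
  · apply chord_aux (c₁ := 0.946) (c₂ := 0.62) (c₃ := 0.4) 0.4 0.451 hx hx' hy hy' h3
      (by linarith) <;>
      norm_num [sinPoly, Finset.sum_range_succ, Nat.factorial]
    linarith

theorem sin_sq_sub_sin_sq (a b : ℝ) : sin a ^ 2 - sin b ^ 2 = sin (a + b) * sin (a - b) := by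
  rw [sin_add, sin_sub]
  linear_combination sin b ^ 2 * sin_sq_add_cos_sq a - sin a ^ 2 * sin_sq_add_cos_sq b

/-- The distance of the agents while the second agent is on the chord. -/
theorem dist_walk_chord_le {x y h K : ℝ} (hK : 1 ≤ K) (hK' : K ≤ 1.046) (hx : 1.02 ≤ x)
    (hx' : x ≤ 1.15) (hy : 0.381 ≤ y) (hy' : y ≤ 0.467) (hh : 0 ≤ h) (hhy : h ≤ sin y) :
    dist (walk (circlePt 0) (circlePt (2 * y)) (2 * h)) (circlePt (2 * (x - h))) ≤
      2 * (sin x - h * K) := by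
  have hπ := pi_gt_three
  have hL : dist (circlePt 0) (circlePt (2 * y)) = 2 * sin y := by
    rw [dist_zero_chord (by linarith) (by linarith), mul_div_cancel_left₀ y two_ne_zero]
  have hsy : 0 < sin y := sin_pos_of_pos_of_lt_pi (by linarith) (by linarith)
  have hsx : 0.85 ≤ sin x := by
    refine le_trans ?_ (sin_le_sin_of_le_of_le_pi_div_two (by linarith) (by linarith) hx)
    exact le_sin_of_le_sinPoly (by norm_num)
      (by norm_num [sinPoly, Finset.sum_range_succ, Nat.factorial])
  have hsx' : sin x ≤ 0.913 := by
    refine (sin_le_sin_of_le_of_le_pi_div_two (by linarith) (by linarith) hx').trans ?_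
    exact sin_le_of_sinPoly_le (by norm_num)
      (by norm_num [sinPoly, Finset.sum_range_succ, Nat.factorial])
  have hsyy : sin y ≤ y := sin_le (by linarith)
  have hpos : 0 ≤ sin x - h * K := by nlinarith
  refine abs_le_of_sq_le_sq' ?_ (by linarith) |>.2
  rw [dist_walk_chord hsy hhy hL]
  -- After squaring, both sides agree at `h = 0`. Dividing the difference by `h` leaves an
  -- inequality implied by `2 K sin x ≤ 1.91` and this bound; the constant is nearly sharp, as
  -- `2·0.913·1.046 = 1.909996`.
  have hb := chord_trig_bound hx hx' hy hy' hh hhy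
  have hsh : h * (1 - h ^ 2 / 6) ≤ sin h := by
    rcases eq_or_lt_of_le hh with rfl | hh0
    · simp
    · have := sin_gt_sub_cube hh0
      nlinarith
  have hs2 : 0 ≤ sin (2 * x - h) :=
    sin_nonneg_of_nonneg_of_le_pi (by linarith) (by linarith)
  have e1 : sin x ^ 2 - sin (x - h) ^ 2 = sin (2 * x - h) * sin h := by
    have := sin_sq_sub_sin_sq x (x - h)
    rwa [show x + (x - h) = 2 * x - h by ring, sub_sub_cancel] at this
  have e2 : 2 * sin (x - h) * cos (x - h - y) = sin (2 * x - 2 * h - y) + sin y := by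
    rw [two_mul_sin_mul_cos, sub_sub_cancel, add_comm,
      show x - h + (x - h - y) = 2 * x - 2 * h - y by ring]
  have e3 : 2 * h * sin (x - h) * cos (x - h - y) = h * (sin (2 * x - 2 * h - y) + sin y) := by
    rw [← e2]; ring
  have h4 := mul_le_mul_of_nonneg_left hsh hs2
  have h5 := mul_le_mul_of_nonneg_left hb hh
  have h6 : 2 * (sin x * K) ≤ 1.91 := by nlinarith
  have h7 := mul_le_mul_of_nonneg_left h6 hh
  have h8 : h ^ 2 ≤ h ^ 2 * K ^ 2 := le_mul_of_one_le_right (sq_nonneg h) (one_le_pow₀ hK)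
  rw [e3]
  nlinarith

/-! ### Location of the root for small `w`. -/

namespace IsRoot

variable {k x y : ℝ}

theorem sin_y_pos (h : IsRoot k x y) : 0 < sin y :=
  sin_pos_of_pos_of_lt_pi h.y_pos (by linarith [h.y_lt, h.x_lt, pi_pos])

/-- Exactly the condition `hret` of `searchCost_detour_le`. With `u = x - y - sin y`, the difference
of the equations is `k x = 2 k y + sin y - k sin u`, so `(1-k) sin y ≤ k sin u` is needed; it
follows from `sin x ≤ x` in the first equation and `sin u ≥ u/2`. -/
theorem x_le (hk : 5 / 6 ≤ k) (hk1 : k ≤ 1) (h : IsRoot k x y) : x ≤ 2 * y + sin y := by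
  have h₁ := h.eq₁
  have h₂ := h.eq₂
  have hy := h.y_lt
  have hx := h.x_lt
  have hsy := h.sin_y_pos
  have hsy' : sin y ≤ y := sin_le h.y_pos.le
  have hsx : sin x ≤ x := sin_le h.x_pos.le
  rw [detourEq₁] at h₁
  rw [detourEq₂] at h₂
  have hu : 0 ≤ x - y - sin y := by linarith
  have h4 := mul_le_sin hu (by linarith [h.y_pos])
  have h5 : (x - y - sin y) / 2 ≤ 2 / π * (x - y - sin y) := by
    rw [div_mul_eq_mul_div, div_le_div_iff₀ two_pos pi_pos]
    nlinarith [pi_le_four]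
  have h6 : k * ((x - y - sin y) / 2) ≤ k * sin (x - y - sin y) :=
    mul_le_mul_of_nonneg_left (by linarith) (by linarith)
  have h7 : k * sin x ≤ k * x := mul_le_mul_of_nonneg_left hsx (by linarith)
  have h8 : (2 * k - 1) * (x - y - sin y) ≤ k * (x - y - sin y) :=
    mul_le_mul_of_nonneg_right (by linarith) hu
  by_contra hlt
  have h9 : k * (2 * y + sin y) < k * x := mul_lt_mul_of_pos_left (not_le.mp hlt) (by linarith)
  nlinarith

/-- `E₂` is already negative at the point of the curve `E₁ = 0` with `x = 1.15`, and by
`detourEq₂_neg_of_lt` it stays negative to the right. -/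
theorem x_lt_of_le (hk : 0.956 ≤ k) (hk1 : k ≤ 1) (h : IsRoot k x y) : x < 1.15 := by
  have hπ := pi_gt_three
  obtain ⟨y', hy0, hy1, hy2⟩ := exists_detourEq₁_eq_zero (x := 1.15) (by linarith) hk1
    (by norm_num) (by linarith)
  have hneg : detourEq₂ k 1.15 y' < 0 := by
    have hS : sin 1.15 ≤ 0.9128 := sin_le_of_sinPoly_le (by norm_num)
      (by norm_num [sinPoly, Finset.sum_range_succ, Nat.factorial])
    have hS' : 0.9127 ≤ sin 1.15 := le_sin_of_le_sinPoly (by norm_num)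
      (by norm_num [sinPoly, Finset.sum_range_succ, Nat.factorial])
    rw [detourEq₁] at hy2
    rw [detourEq₂]
    obtain ⟨q, hq⟩ : ∃ q, q = k * sin 1.15 := ⟨_, rfl⟩
    rw [← hq] at hy2 ⊢
    have hq1 : q ≤ k * 0.9128 := by rw [hq]; gcongr
    have hq2 : 0.8725 ≤ q := by rw [hq]; nlinarith
    have hsum : sin y' + y' ≤ q := by nlinarith
    have hy : y' ≤ 0.4661 - (0.9128 - q) / 2 := by
      by_contra hlt
      push Not at hlt
      set z := 0.4661 - (0.9128 - q) / 2 with hz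
      have h1 := sin_le_sin_of_le_of_le_pi_div_two (x := z) (y := y') (by linarith) (by linarith)
        hlt.le
      have h2 := sin_gt_sub_cube (x := z) (by linarith)
      have h3 : z ^ 3 ≤ 0.4661 ^ 3 := pow_le_pow_left₀ (by linarith) (by linarith) 3
      norm_num at h3
      linarith
    have hsy : 0 ≤ sin y' := sin_nonneg_of_nonneg_of_le_pi hy0.le (by linarith)
    have hu := sin_le_sin_of_le_of_le_pi_div_two (x := 1.15 - q) (y := 1.15 - y' - sin y')
      (by linarith) (by linarith) (by linarith)
    have hv := sin_gt_sub_cube (x := 1.15 - q) (by linarith)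
    have hv3 : (1.15 - q) ^ 3 ≤ 0.2775 ^ 3 := pow_le_pow_left₀ (by linarith) (by linarith) 3
    norm_num at hv3
    have h5 : k * (1.1464 - q) ≤ k * sin (1.15 - y' - sin y') :=
      mul_le_mul_of_nonneg_left (by linarith) (by linarith)
    nlinarith
  by_contra hge
  rcases eq_or_lt_of_le (not_lt.mp hge) with heq | hlt
  · subst heq
    rcases lt_trichotomy y y' with hl | he | hl
    · have := detourEq₁_strictAnti (x := 1.15) (by linarith : 5 / 6 ≤ k) h.y_pos.le
        (by linarith) hl
      rw [h.eq₁, hy2] at this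
      exact lt_irrefl _ this
    · rw [← he, h.eq₂] at hneg
      exact lt_irrefl _ hneg
    · have := detourEq₁_strictAnti (x := 1.15) (by linarith : 5 / 6 ≤ k) hy0.le
        (by linarith [h.y_lt]) hl
      rw [h.eq₁, hy2] at this
      exact lt_irrefl _ this
  · exact (detourEq₂_neg_of_lt (by linarith) (by norm_num) hlt h.x_lt.le hy0 hy1 h.y_pos h.y_lt hy2
      h.eq₁ hneg.le).ne h.eq₂

theorem y_bounds (hk : 0.956 ≤ k) (hk1 : k ≤ 1) (h : IsRoot k x y) (hx : 1.02 ≤ x)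
    (hx' : x ≤ 1.15) : 0.381 ≤ y ∧ y ≤ 0.467 := by
  have hπ := pi_gt_three
  have h₁ := h.eq₁
  have hy := h.y_lt
  have hy0 := h.y_pos
  rw [detourEq₁] at h₁
  have hsx : 0.852 ≤ sin x := by
    refine le_trans ?_ (sin_le_sin_of_le_of_le_pi_div_two (by linarith) (by linarith) hx)
    exact le_sin_of_le_sinPoly (by norm_num)
      (by norm_num [sinPoly, Finset.sum_range_succ, Nat.factorial])
  have hsx' : sin x ≤ 0.913 := by
    refine (sin_le_sin_of_le_of_le_pi_div_two (by linarith) (by linarith) hx').trans ?_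
    exact sin_le_of_sinPoly_le (by norm_num)
      (by norm_num [sinPoly, Finset.sum_range_succ, Nat.factorial])
  constructor
  · have := sin_le hy0.le
    nlinarith
  · by_contra hlt
    have := sin_le_sin_of_le_of_le_pi_div_two (by linarith) (by linarith) (not_le.mp hlt).le
    have h2 : 0.45 ≤ sin 0.467 := le_sin_of_le_sinPoly (by norm_num)
      (by norm_num [sinPoly, Finset.sum_range_succ, Nat.factorial])
    nlinarith

end IsRoot

/-! ### Exact search costs and the final assembly. -/

theorem searchCost_detour_root {w x y : ℝ} (hw : 0 ≤ w) (hw' : w ≤ 0.0457)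
    (h : IsRoot (1 / (w + 1)) x y) (hx : arccos ((w + 1) / 2) ≤ x) :
    searchCost (weightedCost w) (detour (π - x) (2 * y)) =
      ENNReal.ofReal (1 + (π - x) + 2 * sin (π - x) / (w + 1)) := by
  have hπ := pi_gt_three
  have hw0 : 0 < w + 1 := by linarith
  obtain ⟨hk, hk1⟩ := one_div_add_one_bounds hw (by linarith)
  have hk2 : 0.956 ≤ 1 / (w + 1) := by
    rw [le_div_iff₀ hw0]
    linarith
  have hy := h.y_lt
  have hy0 := h.y_pos
  have hx0 := h.x_pos
  have hxπ := h.x_lt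
  have hsy := h.sin_y_pos
  have hsy' : sin y ≤ y := sin_le hy0.le
  have hcos : 2 * cos x ≤ w + 1 := by
    have := cos_le_cos_of_nonneg_of_le_pi (arccos_nonneg _) (by linarith) hx
    rw [cos_arccos (by linarith) (by linarith)] at this
    linarith
  have hx1 : 1.02 ≤ x := by
    refine le_trans ?_ hx
    rw [← arccos_cos (x := 1.02) (by norm_num) (by linarith)]
    refine arccos_le_arccos (le_trans (by linarith : (w + 1) / 2 ≤ 0.523) ?_)
    exact le_cos_of_le_cosPoly (by norm_num)
      (by norm_num [cosPoly, Finset.sum_range_succ, Nat.factorial])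
  have hx2 := (h.x_lt_of_le hk2 hk1).le
  obtain ⟨hy1, hy2⟩ := h.y_bounds hk2 hk1 hx1 hx2
  have hxy := h.x_le hk hk1
  have g13 := γ₁_sub_γ₃ hw x y
  have g12 := γ₁_sub_γ₂ (w := w) x y
  rw [h.eq₁, mul_zero] at g13
  rw [h.eq₂, mul_zero] at g12
  apply le_antisymm
  · apply searchCost_detour_le hw (by linarith) (by linarith) (by linarith) (by linarith)
    · rw [mul_div_cancel_left₀ y two_ne_zero]
      linarith
    · intro s hs hs'
      refine add_sin_le hw hs (by linarith) (by linarith) (by linarith) ?_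
      rw [cos_pi_sub]
      exact mul_nonpos_of_nonpos_of_nonneg (by linarith) (by linarith)
    · intro t ht ht'
      rw [mul_div_cancel_left₀ y two_ne_zero] at ht'
      obtain ⟨r, rfl⟩ : ∃ r, t = 2 * r := ⟨t / 2, by ring⟩
      -- With `t = 2r` the finder is at `c(2(x - r))`; the factor `K = w + 1` makes the saving in
      -- distance pay for the elapsed time `2r`.
      have hd := dist_walk_chord_le (h := r) (K := w + 1) (by linarith) (by linarith) hx1 hx2 hy1 hy2
        (by linarith) (by linarith)
      rw [show -(π - x) - (π - x + 2 * r) = 2 * (x - r) - 2 * π by ring, circlePt_sub_two_pi,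
        sin_pi_sub]
      have : dist (walk (circlePt 0) (circlePt (2 * y)) (2 * r)) (circlePt (2 * (x - r))) / (w + 1) ≤
          2 * sin x / (w + 1) - 2 * r := by
        rw [div_le_iff₀ hw0, sub_mul, div_mul_cancel₀ _ hw0.ne']
        linarith
      linarith
    · rw [abs_of_nonneg]
      · simp only [γ₁, γ₂] at g12
        linarith
      · rw [mul_div_cancel_left₀ y two_ne_zero]
        exact sin_nonneg_of_nonneg_of_le_pi (by linarith) (by linarith)
    · simp only [γ₁] at g13
      linarith
  · exact le_searchCost_detour hw (by linarith) (by linarith) (by linarith) le_rfl (by linarith)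
      (by linarith)

theorem searchCost_detour_pi {w : ℝ} (hw : 0 ≤ w) (hw' : w ≤ 1) :
    searchCost (weightedCost w) (detour π 0) =
      ENNReal.ofReal (1 + arccos (-(w + 1) / 2) +
        2 * sin (arccos (-(w + 1) / 2)) / (w + 1)) := by
  have hπ := pi_gt_three
  have hw0 : 0 < w + 1 := by linarith
  have hd := arccos_nonneg (-(w + 1) / 2)
  have hd' := arccos_le_pi (-(w + 1) / 2)
  have hcos : cos (arccos (-(w + 1) / 2)) = -(w + 1) / 2 :=
    cos_arccos (by linarith) (by linarith)
  set d := arccos (-(w + 1) / 2)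
  have hM : ∀ s, 0 ≤ s → s ≤ π → 1 + s + 2 * sin s / (w + 1) ≤ 1 + d + 2 * sin d / (w + 1) := by
    intro s hs hs'
    refine add_sin_le hw hs hs' hd hd' ?_
    rw [hcos]
    apply le_of_eq
    ring
  have hM' := hM π pi_pos.le le_rfl
  rw [sin_pi, mul_zero, zero_div] at hM'
  apply le_antisymm
  · apply searchCost_detour_le hw hw' pi_pos.le le_rfl (by linarith)
    · simp
      linarith
    · exact hM
    · intro t ht ht'
      rw [zero_div, sin_zero, mul_zero] at ht'
      obtain rfl : t = 0 := le_antisymm ht' ht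
      rw [walk_zero, show -π - (π + 0) = 0 - 2 * π by ring, circlePt_sub_two_pi, dist_self,
        zero_div]
      linarith
    · simp
      linarith
    · have : γ₃ w π 0 = π := by
        rw [γ₃, zero_div, sin_zero]
        field_simp
        ring
      rw [this]
      linarith
  · exact le_searchCost_detour hw pi_pos.le le_rfl hd hd' hd' (by linarith)

end GroupSearch

theorem mainTheorem3 :
    ∃ (α β : ℝ → ℝ) (w₀ : ℝ) (d : ℝ → ℝ),
      -- `(α w, β w)` is the solution of the nonlinear system
      (∀ w ∈ Set.Icc (0 : ℝ) (1 / 5), ∀ x y : ℝ,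
        GroupSearch.IsDetourSolution w x y ↔ x = α w ∧ y = β w) ∧
      -- `w₀` is the threshold at which `α w = arccos (-(w + 1) / 2)`
      w₀ ∈ Set.Icc (0 : ℝ) (1 / 5) ∧
      (∀ w ∈ Set.Icc (0 : ℝ) (1 / 5), α w = Real.arccos (-(w + 1) / 2) ↔ w = w₀) ∧
      |w₀ - 0.0456911| < 1 / 10 ^ 7 ∧
      (∀ w, d w = if w ≤ w₀ then α w else Real.arccos (-(w + 1) / 2)) ∧
      -- the Detour Algorithm is a solution with the claimed search cost
      (∀ w ∈ Set.Icc (0 : ℝ) 1, ∀ a b : ℝ,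
        a = (if w ≤ w₀ then α w else Real.pi) → b = (if w ≤ w₀ then β w else 0) →
        GroupSearch.IsWirelessSearch GroupSearch.disk (GroupSearch.detour a b) ∧
        (∀ (I : GroupSearch.disk) (i : Fin 2),
          GroupSearch.termTime (GroupSearch.detour a b) i I ≠ ⊤) ∧
        GroupSearch.searchCost (GroupSearch.weightedCost w) (GroupSearch.detour a b) =
          ENNReal.ofReal (1 + d w + 2 * Real.sin (d w) / (w + 1))) ∧
      -- the value at `w = 1`, and its optimality
      1 + d 1 + 2 * Real.sin (d 1) / (1 + 1) = 1 + Real.pi ∧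
      IsLeast {C : ℝ≥0∞ | ∃ τ : GroupSearch.disk → Fin 2 → ℝ → GroupSearch.Plane,
          GroupSearch.IsWirelessSearch GroupSearch.disk τ ∧
          C = GroupSearch.searchCost (GroupSearch.weightedCost 1) τ}
        (ENNReal.ofReal (1 + Real.pi)) := by
  classical
  open GroupSearch in
  have hex : ∀ w : ℝ, ∃ q : ℝ × ℝ, w ∈ Set.Icc (0 : ℝ) (1 / 5) → IsRoot (1 / (w + 1)) q.1 q.2 ∧
      ∀ α β, IsDetourSolution w α β ↔ α = Real.pi - q.1 ∧ β = 2 * q.2 := by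
    intro w
    by_cases hw : w ∈ Set.Icc (0 : ℝ) (1 / 5)
    · obtain ⟨x, y, h⟩ := existsUnique_isDetourSolution hw.1 hw.2
      exact ⟨(x, y), fun _ => h⟩
    -- An arbitrary value: no claim concerns the root outside `[0, 1/5]`.
    · exact ⟨0, fun h => absurd h hw⟩
  choose q hq using hex
  obtain ⟨w₀, hw₀, hw₀', hnum, huniq, hsign⟩ := GroupSearch.exists_threshold
  have hπ := Real.pi_gt_three
  have harc : ∀ w : ℝ, Real.arccos (-(w + 1) / 2) = Real.pi - Real.arccos ((w + 1) / 2) := by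
    intro w
    rw [neg_div, Real.arccos_neg]
  have hw₀s : w₀ ≤ 0.0457 := by linarith [(abs_lt.mp hnum).2]
  have hcost : ∀ w ∈ Set.Icc (0 : ℝ) 1,
      GroupSearch.searchCost (GroupSearch.weightedCost w)
        (GroupSearch.detour (if w ≤ w₀ then Real.pi - (q w).1 else Real.pi)
          (if w ≤ w₀ then 2 * (q w).2 else 0)) =
        ENNReal.ofReal (1 + (if w ≤ w₀ then Real.pi - (q w).1 else Real.arccos (-(w + 1) / 2)) +
          2 * Real.sin (if w ≤ w₀ then Real.pi - (q w).1 else Real.arccos (-(w + 1) / 2)) /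
            (w + 1)) := by
    intro w hw
    split_ifs with h
    · have hroot := (hq w ⟨hw.1, h.trans hw₀'⟩).1
      exact GroupSearch.searchCost_detour_root hw.1 (h.trans hw₀s) hroot
        (hsign w _ _ hw.1 h hroot)
    · exact GroupSearch.searchCost_detour_pi hw.1 hw.2
  have hpar : ∀ w ∈ Set.Icc (0 : ℝ) 1, 0 ≤ (if w ≤ w₀ then Real.pi - (q w).1 else Real.pi) ∧
      0 ≤ (if w ≤ w₀ then 2 * (q w).2 else 0) ∧
      (if w ≤ w₀ then Real.pi - (q w).1 else Real.pi) + (if w ≤ w₀ then 2 * (q w).2 else 0) ≤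
        2 * Real.pi := by
    intro w hw
    split_ifs with h
    · have hroot := (hq w ⟨hw.1, h.trans hw₀'⟩).1
      have h1 := hroot.x_pos
      have h2 := hroot.x_lt
      have h3 := hroot.y_pos
      have h4 := hroot.y_lt
      exact ⟨by linarith, by linarith, by linarith⟩
    · exact ⟨by linarith, le_rfl, by linarith⟩
  have hd1 : (if (1 : ℝ) ≤ w₀ then Real.pi - (q 1).1 else Real.arccos (-(1 + 1) / 2)) =
      Real.pi := by
    rw [if_neg (by linarith), show (-(1 + 1) / 2 : ℝ) = -1 by norm_num, Real.arccos_neg_one]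
  have hval : 1 + Real.pi + 2 * Real.sin Real.pi / (1 + 1) = 1 + Real.pi := by
    rw [Real.sin_pi, mul_zero, zero_div, add_zero]
  refine ⟨fun w => Real.pi - (q w).1, fun w => 2 * (q w).2, w₀,
    fun w => if w ≤ w₀ then Real.pi - (q w).1 else Real.arccos (-(w + 1) / 2),
    fun w hw x y => (hq w hw).2 x y, ⟨hw₀, hw₀'⟩, ?_, hnum, fun _ => rfl, ?_, ?_, ?_, ?_⟩
  · intro w hw
    rw [← huniq w _ _ hw.1 hw.2 (hq w hw).1, harc]
    constructor <;> intro h <;> linarith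
  · rintro w hw a b rfl rfl
    obtain ⟨ha, hb, hab⟩ := hpar w hw
    exact ⟨GroupSearch.isWirelessSearch_respond
        (GroupSearch.isTrajectoryPair_detour ha hb hab) GroupSearch.disk,
      GroupSearch.termTime_detour_ne_top ha hb hab, hcost w hw⟩
  · simp only [hd1]
    exact hval
  · have h1 : (1 : ℝ) ∈ Set.Icc (0 : ℝ) 1 := ⟨zero_le_one, le_rfl⟩
    obtain ⟨ha, hb, hab⟩ := hpar 1 h1
    refine ⟨_, GroupSearch.isWirelessSearch_respond
        (GroupSearch.isTrajectoryPair_detour ha hb hab) GroupSearch.disk, ?_⟩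
    have := hcost 1 h1
    rw [hd1, hval] at this
    exact this.symm
  · rintro _ ⟨τ, hτ, rfl⟩
    exact GroupSearch.le_searchCost_one hτ
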